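/- Let $d\ge 1$ and let $k_1,\dots,k_d,l_1,\dots,l_d$ be positive even integers with $$\min_{1\le i\le d}(k_il_i-1)>\max_{1\le i\le d}\max(k_i,l_i).$$ Let $e_1,\dots,e_d$ be the standard unit vectors of $\mathbb Z^d$. Let $a_i,b_i$ $(1\le i\le d)$ and $f_{-4,n},f_{-3,n},f_{-2,n},f_{-1,n}$ $(n\in\mathbb Z^d)$ be independent indeterminates, and let $\mathbb K$ be the field of fractions of the polynomial ring over $\mathbb Z$ in all of them. Define $f_{t,n}\in\mathbb K$ for all integers $t\ge 0$ and all $n\in\mathbb Z^d$ recursively by the equation $$f_{t+2,n}=-\frac{F_{t+1,n}f_{t-2,n}}{F_{t-1,n}}+\sum_{i=1}^d\left\{\frac{a_iF_{t+1,n}F_{t,n+e_i}^{k_i}}{f_{t,n}f_{t+1,n+e_i}^{k_i}f_{t-1,n+e_i}^{k_i}}+\frac{b_iF_{t+1,n}F_{t,n-e_i}^{l_i}}{f_{t,n}f_{t+1,n-e_i}^{l_i}f_{t-1,n-e_i}^{l_i}}\right\}\qquad(t\ge -2),$$ where $F_{t,n}:=\prod_{i=1}^d f_{t,n+e_i}^{k_i}f_{t,n-e_i}^{l_i}$.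 Let $$\mathcal R:=\mathbb Z\left[\{f_{-4,n}^{\pm1},f_{-3,n}^{\pm1},f_{-2,n}^{\pm1},f_{-1,n}^{\pm1}\}_{n\in\mathbb Z^d},\{a_i,b_i\}_{1\le i\le d}\right]\subset\mathbb K .$$ Then $f_{t,n}\in\mathcal R$ for all $t\ge -4$ and $n\in\mathbb Z^d$; $f_{t,n}$ is irreducible in $\mathcal R$ for all $t\ge 0$ and $n\in\mathbb Z^d$; and for all $(t,n)\ne(s,m)$ with $t,s\ge -4$ and $n,m\in\mathbb Z^d$, the elements $f_{t,n}$ and $f_{s,m}$ are coprime in $\mathcal R$, i.e. every common divisor of them in $\mathcal R$ is a unit of $\mathcal R$. -/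

import Mathlib

namespace TauKdV

/-- Points `n` of the space lattice `ℤ ^ d`. -/
abbrev Site (d : ℕ) : Type := Fin d → ℤ

/-- The unit vector `e_i` of `ℤ ^ d`. -/
def e {d : ℕ} (i : Fin d) : Site d := Pi.single i 1

/-- The indeterminates: `init s n` is the initial variable `f_{s - 4, n}` (so `s = 0, 1, 2, 3`
stands for time `-4, -3, -2, -1`), and `a i`, `b i` are the parameters. -/
inductive Var (d : ℕ) : Type
  | init (s : Fin 4) (n : Site d) : Var d
  | a (i : Fin d) : Var d
  | b (i : Fin d) : Var d

/-- The field of rational functions over `ℚ` in all the indeterminates, as the field of fractions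
of the polynomial ring over `ℤ`. -/
abbrev RatFun (d : ℕ) : Type := FractionRing (MvPolynomial (Var d) ℤ)

/-- An indeterminate, as a rational function. -/
noncomputable def gen {d : ℕ} (v : Var d) : RatFun d :=
  algebraMap (MvPolynomial (Var d) ℤ) (RatFun d) (MvPolynomial.X v)

/-- The ring `ℤ[f_{-4,n}^±, f_{-3,n}^±, f_{-2,n}^±, f_{-1,n}^±, a_i, b_i]`, Laurent in the initial
variables and polynomial in the parameters, inside the field of rational functions. -/
noncomputable def laurentRing (d : ℕ) : Subalgebra ℤ (RatFun d) :=
  Algebra.adjoin ℤ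
    ({x | ∃ (s : Fin 4) (n : Site d), x = gen (Var.init s n) ∨ x = (gen (Var.init s n))⁻¹} ∪
      {x | ∃ i : Fin d, x = gen (Var.a i) ∨ x = gen (Var.b i)})

/-- `F_n = ∏_i f_{n + e_i} ^ k_i * f_{n - e_i} ^ l_i` for one time slice `f`. -/
noncomputable def nbrProd {d : ℕ} (k l : Fin d → ℕ) (f : Site d → RatFun d) (n : Site d) :
    RatFun d :=
  ∏ i, f (n + e i) ^ k i * f (n - e i) ^ l i

/-- One step of the evolution: the slice at time `t + 2` from the slices `f₀`, `f₁`, `f₂`, `f₃` at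
times `t - 2`, `t - 1`, `t`, `t + 1`. -/
noncomputable def step {d : ℕ} (k l : Fin d → ℕ) (f₀ f₁ f₂ f₃ : Site d → RatFun d) (n : Site d) :
    RatFun d :=
  -(nbrProd k l f₃ n * f₀ n / nbrProd k l f₁ n) +
    ∑ i,
      (gen (Var.a i) * nbrProd k l f₃ n * nbrProd k l f₂ (n + e i) ^ k i /
          (f₂ n * f₃ (n + e i) ^ k i * f₁ (n + e i) ^ k i) +
        gen (Var.b i) * nbrProd k l f₃ n * nbrProd k l f₂ (n - e i) ^ l i /
          (f₂ n * f₃ (n - e i) ^ l i * f₁ (n - e i) ^ l i))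

/-- The time slices, counted from `0` (which stands for time `-4`). -/
noncomputable def slice {d : ℕ} (k l : Fin d → ℕ) : ℕ → Site d → RatFun d
  | 0 => fun n => gen (Var.init 0 n)
  | 1 => fun n => gen (Var.init 1 n)
  | 2 => fun n => gen (Var.init 2 n)
  | 3 => fun n => gen (Var.init 3 n)
  | m + 4 => step k l (slice k l m) (slice k l (m + 1)) (slice k l (m + 2)) (slice k l (m + 3))

/-- The iterate `f_{t,n}`, for `t ≥ -4` (the value for `t < -4` is irrelevant). -/
noncomputable def tau {d : ℕ} (k l : Fin d → ℕ) (t : ℤ) (n : Site d) : RatFun d :=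
  slice k l (t + 4).toNat n

/-- The initial values of the iterates are the initial variables. -/
theorem tau_init {d : ℕ} (k l : Fin d → ℕ) (s : Fin 4) (n : Site d) :
    tau k l ((s : ℕ) - 4 : ℤ) n = gen (Var.init s n) := by
  fin_cases s <;> rfl

/-- The iterates satisfy the recurrence. -/
theorem tau_add_two {d : ℕ} (k l : Fin d → ℕ) (t : ℤ) (ht : -2 ≤ t) (n : Site d) :
    tau k l (t + 2) n =
      -(nbrProd k l (tau k l (t + 1)) n * tau k l (t - 2) n / nbrProd k l (tau k l (t - 1)) n) +
        ∑ i,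
          (gen (Var.a i) * nbrProd k l (tau k l (t + 1)) n *
                nbrProd k l (tau k l t) (n + e i) ^ k i /
              (tau k l t n * tau k l (t + 1) (n + e i) ^ k i * tau k l (t - 1) (n + e i) ^ k i) +
            gen (Var.b i) * nbrProd k l (tau k l (t + 1)) n *
                nbrProd k l (tau k l t) (n - e i) ^ l i /
              (tau k l t n * tau k l (t + 1) (n - e i) ^ l i *
                tau k l (t - 1) (n - e i) ^ l i)) := by
  obtain ⟨m, rfl⟩ : ∃ m : ℕ, t = (m : ℤ) - 2 := ⟨(t + 2).toNat, by omega⟩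
  have h0 : tau k l ((m : ℤ) - 2 - 2) = slice k l m := by
    funext x; unfold tau; congr 1; omega
  have h1 : tau k l ((m : ℤ) - 2 - 1) = slice k l (m + 1) := by
    funext x; unfold tau; congr 1; omega
  have h2 : tau k l ((m : ℤ) - 2) = slice k l (m + 2) := by
    funext x; unfold tau; congr 1; omega
  have h3 : tau k l ((m : ℤ) - 2 + 1) = slice k l (m + 3) := by
    funext x; unfold tau; congr 1; omega
  have h4 : tau k l ((m : ℤ) - 2 + 2) = slice k l (m + 4) := by
    funext x; unfold tau; congr 1; omega
  rw [h0, h1, h2, h3, h4]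
  rfl

end TauKdV

/-! Count time from 0, so that f_0, ..., f_3 are the initial slices and f_4 is the first computed
one. The recurrence is reversible, and any four consecutive slices together with the parameters are
again algebraically independent, so every statement may be shifted in time or run backwards. Let B
be the Laurent ring of the slices 0 to 3, B' that of the slices 1 to 4, and C the ring that is
Laurent in slices 1 to 3 and only polynomial in f_0. By reversibility C is also the ring that is
Laurent in slices 1 to 3 and polynomial in f_4 (`genRing_late_eq`). Thus B is C with the primes
f_{0,n} inverted and B' is C with the primes f_{4,n} inverted. The induction on t, over all data at
once (`goodAt`), proves that f_t lies in C, that it is prime in B, and that no f_{4,m} divides it in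
C when t ≥ 5. Shifted by one step, the hypothesis says that f_t is prime in B'. It then lies in C if
it is regular at each prime f_{4,m}; non-divisibility lets primality descend from B' to C, and it
ascends to B because f_t is not associated to any f_{0,m}. Regularity at f_{4,m}: for t = 5, 6 the
denominators cancel explicitly. For t = 7 it is singularity confinement. In terms of x_t = f_t
f_{t-2} / F_{t-1} the recurrence expresses x_{t+1} + x_{t-1} through x_t alone. A zero of x_4 at m
gives x_5 poles at the neighbours of m, then x_6 = -x_4 (1 - η) at m with η of high order, and x_7 -
x_3 is regular: even exponents remove the sign, and the lower bound on k_i l_i makes η small enough.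
For t = 8 one step from slices 4 to 7 suffices, and for t ≥ 9 f_t is Laurent in slices 5 to 8, which
are prime to f_{4,m}. Non-divisibility by f_{4,m}: for t = 5, 6, 7 by a 2-adic specialization
(`iter_order_bound`), for t ≥ 8 by time reversal (`not_dvdIn_iter_four_of_good`). Associated primes
differ by a unit, that is, a monomial up to sign. A real solution with initial values 1 and strictly
decreasing absolute values separates different times; a rational solution vanishing at one site
separates different sites at time 4. -/

namespace TauKdV

/-! ### The evolution over a field: ratios, reversibility, shifts in time. -/

section Evolution

variable {d : ℕ}

/-- The neighbour product of a time slice with values in a commutative ring. -/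
def neighborProd {E : Type*} [CommRing E] (k l : Fin d → ℕ) (f : Site d → E) (n : Site d) : E :=
  ∏ i, f (n + e i) ^ k i * f (n - e i) ^ l i

/-- The evolution as a polynomial expression in the slices `f₀`, ..., `f₃` and in slices `g₁`,
`g₂`, `g₃` that play the role of inverses. -/
def evolve {E : Type*} [CommRing E] (k l : Fin d → ℕ) (a b : Fin d → E)
    (f₀ f₂ f₃ g₁ g₂ g₃ : Site d → E) (n : Site d) : E :=
  -(neighborProd k l f₃ n * f₀ n * neighborProd k l g₁ n) +
    ∑ i,
      (a i * neighborProd k l f₃ n * neighborProd k l f₂ (n + e i) ^ k i *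
          (g₂ n * g₃ (n + e i) ^ k i * g₁ (n + e i) ^ k i) +
        b i * neighborProd k l f₃ n * neighborProd k l f₂ (n - e i) ^ l i *
          (g₂ n * g₃ (n - e i) ^ l i * g₁ (n - e i) ^ l i))

/-- One step of the evolution in a field. -/
def next {L : Type*} [Field L] (k l : Fin d → ℕ) (a b : Fin d → L)
    (f₀ f₁ f₂ f₃ : Site d → L) (n : Site d) : L :=
  -(neighborProd k l f₃ n * f₀ n / neighborProd k l f₁ n) +
    ∑ i,
      (a i * neighborProd k l f₃ n * neighborProd k l f₂ (n + e i) ^ k i /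
          (f₂ n * f₃ (n + e i) ^ k i * f₁ (n + e i) ^ k i) +
        b i * neighborProd k l f₃ n * neighborProd k l f₂ (n - e i) ^ l i /
          (f₂ n * f₃ (n - e i) ^ l i * f₁ (n - e i) ^ l i))

/-- The variables `x_t = f_t f_{t - 2} / F_{t - 1}` of the underlying nonlinear equation. -/
def ratio {L : Type*} [Field L] (k l : Fin d → ℕ) (f₀ f₁ f₂ : Site d → L) (n : Site d) : L :=
  f₂ n * f₀ n / neighborProd k l f₁ n

/-- The time slices with initial data and parameters in a field. -/
def iter {L : Type*} [Field L] (k l : Fin d → ℕ) (x : Var d → L) : ℕ → Site d → L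
  | 0 => fun n => x (Var.init 0 n)
  | 1 => fun n => x (Var.init 1 n)
  | 2 => fun n => x (Var.init 2 n)
  | 3 => fun n => x (Var.init 3 n)
  | m + 4 => next k l (fun i => x (Var.a i)) (fun i => x (Var.b i))
      (iter k l x m) (iter k l x (m + 1)) (iter k l x (m + 2)) (iter k l x (m + 3))

/-- The data of a solution at the times `N`, ..., `N + 3`. -/
def shift {L : Type*} [Field L] (k l : Fin d → ℕ) (x : Var d → L) (N : ℕ) : Var d → L
  | Var.init j n => iter k l x (N + j) n
  | Var.a i => x (Var.a i)
  | Var.b i => x (Var.b i)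

/-- Time reversal of initial data. -/
def rev {L : Type*} (x : Var d → L) : Var d → L
  | Var.init j n => x (Var.init j.rev n)
  | Var.a i => x (Var.a i)
  | Var.b i => x (Var.b i)

variable {L : Type*} [Field L] (k l : Fin d → ℕ)

theorem slice_eq_iter (t : ℕ) : slice k l t = iter k l (gen (d := d)) t := by
  induction t using Nat.strong_induction_on with
  | _ t ih =>
    match t with
    | 0 | 1 | 2 | 3 => rfl
    | m + 4 =>
      have h0 := ih m (by omega)
      have h1 := ih (m + 1) (by omega)
      have h2 := ih (m + 2) (by omega)
      have h3 := ih (m + 3) (by omega)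
      simp only [slice, iter, h0, h1, h2, h3]
      rfl

theorem neighborProd_ne_zero {f : Site d → L} (hf : ∀ n, f n ≠ 0) (n : Site d) :
    neighborProd k l f n ≠ 0 :=
  Finset.prod_ne_zero_iff.2 fun _ _ => mul_ne_zero (pow_ne_zero _ (hf _)) (pow_ne_zero _ (hf _))

theorem neighborProd_inv (f : Site d → L) (n : Site d) :
    neighborProd k l (fun m => (f m)⁻¹) n = (neighborProd k l f n)⁻¹ := by
  simp only [neighborProd, ← Finset.prod_inv_distrib, mul_inv, inv_pow]

theorem next_eq_evolve (a b : Fin d → L) (f₀ f₁ f₂ f₃ : Site d → L) :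
    next k l a b f₀ f₁ f₂ f₃ = evolve k l a b f₀ f₂ f₃ (fun n => (f₁ n)⁻¹) (fun n => (f₂ n)⁻¹)
      (fun n => (f₃ n)⁻¹) := by
  funext n
  simp only [next, evolve, neighborProd_inv, div_eq_mul_inv, mul_inv, inv_pow]

theorem neighborProd_mem {E : Type*} [CommRing E] (A : Subring E) {f : Site d → E}
    (hf : ∀ n, f n ∈ A) (n : Site d) : neighborProd k l f n ∈ A :=
  prod_mem fun _ _ => mul_mem (pow_mem (hf _) _) (pow_mem (hf _) _)

theorem evolve_mem {E : Type*} [CommRing E] (A : Subring E) {a b : Fin d → E}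
    {f₀ f₂ f₃ g₁ g₂ g₃ : Site d → E} (ha : ∀ i, a i ∈ A) (hb : ∀ i, b i ∈ A)
    (h0 : ∀ n, f₀ n ∈ A) (h2 : ∀ n, f₂ n ∈ A) (h3 : ∀ n, f₃ n ∈ A)
    (g1 : ∀ n, g₁ n ∈ A) (g2 : ∀ n, g₂ n ∈ A) (g3 : ∀ n, g₃ n ∈ A) (n : Site d) :
    evolve k l a b f₀ f₂ f₃ g₁ g₂ g₃ n ∈ A := by
  have H2 := neighborProd_mem k l A h2
  have H3 := neighborProd_mem k l A h3
  have G1 := neighborProd_mem k l A g1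
  refine add_mem (neg_mem (mul_mem (mul_mem (H3 _) (h0 _)) (G1 _))) (sum_mem fun i _ => ?_)
  exact add_mem
    (mul_mem (mul_mem (mul_mem (ha i) (H3 _)) (pow_mem (H2 _) _))
      (mul_mem (mul_mem (g2 _) (pow_mem (g3 _) _)) (pow_mem (g1 _) _)))
    (mul_mem (mul_mem (mul_mem (hb i) (H3 _)) (pow_mem (H2 _) _))
      (mul_mem (mul_mem (g2 _) (pow_mem (g3 _) _)) (pow_mem (g1 _) _)))

theorem next_mem (A : Subring L) {a b : Fin d → L} {f₀ f₁ f₂ f₃ : Site d → L}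
    (ha : ∀ i, a i ∈ A) (hb : ∀ i, b i ∈ A) (h0 : ∀ n, f₀ n ∈ A) (h2 : ∀ n, f₂ n ∈ A)
    (h3 : ∀ n, f₃ n ∈ A) (g1 : ∀ n, (f₁ n)⁻¹ ∈ A) (g2 : ∀ n, (f₂ n)⁻¹ ∈ A)
    (g3 : ∀ n, (f₃ n)⁻¹ ∈ A) (n : Site d) : next k l a b f₀ f₁ f₂ f₃ n ∈ A := by
  rw [next_eq_evolve]
  exact evolve_mem k l A ha hb h0 h2 h3 g1 g2 g3 n

theorem map_evolve {E E' : Type*} [CommRing E] [CommRing E'] (φ : E →+* E') (a b : Fin d → E)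
    (f₀ f₂ f₃ g₁ g₂ g₃ : Site d → E) (n : Site d) :
    φ (evolve k l a b f₀ f₂ f₃ g₁ g₂ g₃ n) =
      evolve k l (fun i => φ (a i)) (fun i => φ (b i)) (fun n => φ (f₀ n)) (fun n => φ (f₂ n))
        (fun n => φ (f₃ n)) (fun n => φ (g₁ n)) (fun n => φ (g₂ n)) (fun n => φ (g₃ n)) n := by
  simp only [evolve, neighborProd, map_add, map_neg, map_mul, map_sum, map_prod, map_pow]

/-- A subring of a product of two fields that is closed under inversion where the second
component does not vanish is closed under the evolution. -/
theorem next_mem_prod {F : Type*} [Field F] (Γ : Subring (L × F))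
    (hΓ : ∀ z ∈ Γ, z.2 ≠ 0 → (z.1⁻¹, z.2⁻¹) ∈ Γ) {a b : Fin d → L} {a' b' : Fin d → F}
    {f₀ f₁ f₂ f₃ : Site d → L} {g₀ g₁ g₂ g₃ : Site d → F}
    (ha : ∀ i, (a i, a' i) ∈ Γ) (hb : ∀ i, (b i, b' i) ∈ Γ) (h0 : ∀ n, (f₀ n, g₀ n) ∈ Γ)
    (h1 : ∀ n, (f₁ n, g₁ n) ∈ Γ) (h2 : ∀ n, (f₂ n, g₂ n) ∈ Γ) (h3 : ∀ n, (f₃ n, g₃ n) ∈ Γ)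
    (n1 : ∀ n, g₁ n ≠ 0) (n2 : ∀ n, g₂ n ≠ 0) (n3 : ∀ n, g₃ n ≠ 0) (n : Site d) :
    (next k l a b f₀ f₁ f₂ f₃ n, next k l a' b' g₀ g₁ g₂ g₃ n) ∈ Γ := by
  have := evolve_mem k l Γ (a := fun i => (a i, a' i)) (b := fun i => (b i, b' i))
    (f₀ := fun n => (f₀ n, g₀ n)) (f₂ := fun n => (f₂ n, g₂ n)) (f₃ := fun n => (f₃ n, g₃ n))
    (g₁ := fun n => ((f₁ n)⁻¹, (g₁ n)⁻¹)) (g₂ := fun n => ((f₂ n)⁻¹, (g₂ n)⁻¹))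
    (g₃ := fun n => ((f₃ n)⁻¹, (g₃ n)⁻¹)) ha hb h0 h2 h3 (fun n => hΓ _ (h1 n) (n1 n))
    (fun n => hΓ _ (h2 n) (n2 n)) (fun n => hΓ _ (h3 n) (n3 n)) n
  convert this using 1
  rw [next_eq_evolve, next_eq_evolve]
  have hfst := map_evolve k l (RingHom.fst L F) (fun i => (a i, a' i)) (fun i => (b i, b' i))
    (fun n => (f₀ n, g₀ n)) (fun n => (f₂ n, g₂ n)) (fun n => (f₃ n, g₃ n))
    (fun n => ((f₁ n)⁻¹, (g₁ n)⁻¹)) (fun n => ((f₂ n)⁻¹, (g₂ n)⁻¹))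
    (fun n => ((f₃ n)⁻¹, (g₃ n)⁻¹)) n
  have hsnd := map_evolve k l (RingHom.snd L F) (fun i => (a i, a' i)) (fun i => (b i, b' i))
    (fun n => (f₀ n, g₀ n)) (fun n => (f₂ n, g₂ n)) (fun n => (f₃ n, g₃ n))
    (fun n => ((f₁ n)⁻¹, (g₁ n)⁻¹)) (fun n => ((f₂ n)⁻¹, (g₂ n)⁻¹))
    (fun n => ((f₃ n)⁻¹, (g₃ n)⁻¹)) n
  exact Prod.ext hfst.symm hsnd.symm

/-- Multiplying the recurrence by f₂ / F₃ leaves only ratios. In this form each new slice depends on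
two old ones, so a degeneration at one site can be followed. -/
theorem ratio_next (a b : Fin d → L) {f₀ f₁ f₂ f₃ : Site d → L}
    (h2 : ∀ n, f₂ n ≠ 0) (h3 : ∀ n, f₃ n ≠ 0) (n : Site d) :
    ratio k l f₂ f₃ (next k l a b f₀ f₁ f₂ f₃) n = -ratio k l f₀ f₁ f₂ n +
      ∑ i, (a i / ratio k l f₁ f₂ f₃ (n + e i) ^ k i +
        b i / ratio k l f₁ f₂ f₃ (n - e i) ^ l i) := by
  have H3 := neighborProd_ne_zero k l h3 n
  have hn := h2 n
  simp only [ratio, next]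
  rw [add_mul, add_div, Finset.sum_mul, Finset.sum_div]
  congr 1
  · field_simp
  · refine Finset.sum_congr rfl fun i _ => ?_
    rw [add_mul, add_div, div_pow, div_pow, mul_pow, mul_pow]
    congr 1 <;> · field_simp

/-- Dividing the recurrence by F₃ gives f₄ / F₃ + f₀ / F₁ = an expression symmetric in f₁ and f₃, so
the same rule also computes f₀ from f₄. -/
theorem next_next (a b : Fin d → L) {f₀ f₁ f₂ f₃ : Site d → L}
    (h1 : ∀ n, f₁ n ≠ 0) (h3 : ∀ n, f₃ n ≠ 0) :
    next k l a b (next k l a b f₀ f₁ f₂ f₃) f₃ f₂ f₁ = f₀ := by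
  have key : ∀ (f₀ f₁ f₃ : Site d → L) (n : Site d), next k l a b f₀ f₁ f₂ f₃ n =
      neighborProd k l f₃ n * (-(f₀ n / neighborProd k l f₁ n) + ∑ i,
        (a i * neighborProd k l f₂ (n + e i) ^ k i /
          (f₂ n * (f₃ (n + e i) ^ k i * f₁ (n + e i) ^ k i)) +
        b i * neighborProd k l f₂ (n - e i) ^ l i /
          (f₂ n * (f₃ (n - e i) ^ l i * f₁ (n - e i) ^ l i)))) := by
    intro f₀ f₁ f₃ n
    rw [next, mul_add, Finset.mul_sum]
    congr 1
    · ring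
    · refine Finset.sum_congr rfl fun i _ => ?_
      ring
  funext n
  have H3 := neighborProd_ne_zero k l h3 n
  have H1 := neighborProd_ne_zero k l h1 n
  rw [key _ f₃ f₁, key _ f₁ f₃, mul_div_cancel_left₀ _ H3]
  simp only [mul_comm (f₁ _ ^ _) (f₃ _ ^ _)]
  field_simp
  ring

theorem iter_shift (x : Var d → L) (N t : ℕ) :
    iter k l (shift k l x N) t = iter k l x (N + t) := by
  induction t using Nat.strong_induction_on with
  | _ t ih =>
    match t with
    | 0 | 1 | 2 | 3 => rfl
    | m + 4 =>
      have h0 := ih m (by omega)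
      have h1 := ih (m + 1) (by omega)
      have h2 := ih (m + 2) (by omega)
      have h3 := ih (m + 3) (by omega)
      simp only [iter, h0, h1, h2, h3]
      rfl

theorem shift_shift (x : Var d → L) (M N : ℕ) :
    shift k l (shift k l x M) N = shift k l x (M + N) := by
  funext v
  cases v with
  | init j n => simp only [shift, iter_shift, add_assoc]
  | a i => rfl
  | b i => rfl

theorem shift_zero (x : Var d → L) : shift k l x 0 = x := by
  funext v
  cases v with
  | init j n => fin_cases j <;> rfl
  | a i => rfl
  | b i => rfl

theorem rev_rev {E : Type*} (x : Var d → E) : rev (rev x) = x := by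
  funext v
  cases v with
  | init j n => simp [rev]
  | a i => rfl
  | b i => rfl

/-- Running a solution backwards. -/
theorem iter_rev_shift {x : Var d → L} (hx : ∀ t n, iter k l x t n ≠ 0) (N t : ℕ)
    (ht : t ≤ N + 3) : iter k l (rev (shift k l x N)) t = iter k l x (N + 3 - t) := by
  induction t using Nat.strong_induction_on with
  | _ t ih =>
    match t with
    | 0 | 1 | 2 | 3 => rfl
    | m + 4 =>
      obtain ⟨M, rfl⟩ : ∃ M, N = M + m + 1 := ⟨N - m - 1, by omega⟩
      have h0 := ih m (by omega) (by omega)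
      have h1 := ih (m + 1) (by omega) (by omega)
      have h2 := ih (m + 2) (by omega) (by omega)
      have h3 := ih (m + 3) (by omega) (by omega)
      rw [show M + m + 1 + 3 - m = M + 4 by omega] at h0
      rw [show M + m + 1 + 3 - (m + 1) = M + 3 by omega] at h1
      rw [show M + m + 1 + 3 - (m + 2) = M + 2 by omega] at h2
      rw [show M + m + 1 + 3 - (m + 3) = M + 1 by omega] at h3
      rw [show M + m + 1 + 3 - (m + 4) = M by omega, iter, h0, h1, h2, h3]
      exact next_next k l _ _ (hx _) (hx _)

end Evolution

/-! ### Divisibility and primes in subrings of one field, and their behaviour under localization. -/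

section Subrings

variable {L : Type*} [Field L]

/-- Divisibility in a subring of a field. -/
def DvdIn (A : Subring L) (p g : L) : Prop := ∃ c ∈ A, g = p * c

/-- Prime elements of a subring of a field. -/
structure PrimeIn (A : Subring L) (p : L) : Prop where
  mem : p ∈ A
  ne_zero : p ≠ 0
  not_dvd_one : ¬ DvdIn A p 1
  dvd_or_dvd : ∀ a ∈ A, ∀ b ∈ A, DvdIn A p (a * b) → DvdIn A p a ∨ DvdIn A p b

theorem DvdIn.mono {A B : Subring L} (hAB : A ≤ B) {p g : L} (h : DvdIn A p g) : DvdIn B p g := by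
  obtain ⟨c, hc, rfl⟩ := h
  exact ⟨c, hAB hc, rfl⟩

theorem DvdIn.mul_left {A : Subring L} {p g c : L} (h : DvdIn A p g) (hc : c ∈ A) :
    DvdIn A p (c * g) := by
  obtain ⟨c', hc', rfl⟩ := h
  exact ⟨c * c', mul_mem hc hc', by ring⟩

theorem PrimeIn.not_dvdIn_mul {A : Subring L} {p : L} (hp : PrimeIn A p) {a b : L} (ha : a ∈ A)
    (hb : b ∈ A) (hpa : ¬ DvdIn A p a) (hpb : ¬ DvdIn A p b) : ¬ DvdIn A p (a * b) := fun h =>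
  (hp.dvd_or_dvd a ha b hb h).elim hpa hpb

theorem closure_le_subring {A : Subring L} {S : Set L} (hS : S ⊆ A) {s : L}
    (hs : s ∈ Submonoid.closure S) : s ∈ A :=
  (Submonoid.closure_le (S := A.toSubmonoid)).2 hS hs

theorem closure_ne_zero {S : Set L} (hS : ∀ s ∈ S, s ≠ 0) {s : L}
    (hs : s ∈ Submonoid.closure S) : s ≠ 0 := by
  induction hs using Submonoid.closure_induction with
  | mem x hx => exact hS x hx
  | one => exact one_ne_zero
  | mul x y _ _ hx hy => exact mul_ne_zero hx hy

theorem PrimeIn.not_dvdIn_closure {A : Subring L} {p : L} (hp : PrimeIn A p) {S : Set L}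
    (hSA : S ⊆ A) (hS : ∀ s ∈ S, ¬ DvdIn A p s) {s : L} (hs : s ∈ Submonoid.closure S) :
    ¬ DvdIn A p s := by
  induction hs using Submonoid.closure_induction with
  | mem x hx => exact hS x hx
  | one => exact hp.not_dvd_one
  | mul x y hx hy hx' hy' =>
    exact hp.not_dvdIn_mul (closure_le_subring hSA hx) (closure_le_subring hSA hy) hx' hy'

/-- Two primes one of which divides the other differ by a unit. -/
theorem PrimeIn.unit_of_dvdIn {A : Subring L} {p q : L} (hp : PrimeIn A p) (hq : PrimeIn A q)
    (h : DvdIn A p q) : ∃ u ∈ A, u⁻¹ ∈ A ∧ q = p * u := by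
  obtain ⟨u, hu, rfl⟩ := h
  refine ⟨u, hu, ?_, rfl⟩
  have hu0 : u ≠ 0 := right_ne_zero_of_mul hq.ne_zero
  rcases hq.dvd_or_dvd p hp.mem u hu ⟨1, one_mem _, by ring⟩ with ⟨c, hc, h⟩ | ⟨c, hc, h⟩
  · have : u * c = 1 := mul_left_cancel₀ hp.ne_zero (by rw [← mul_assoc, ← h, mul_one])
    rwa [inv_eq_of_mul_eq_one_right this]
  · have : p * c = 1 := mul_left_cancel₀ hu0 (by linear_combination -h)
    exact absurd ⟨c, hc, this.symm⟩ hp.not_dvd_one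

/-- An element of the fraction field whose denominator can be chosen prime to every element of
`S`, and also as a product of elements of `S`, lies in the ring. -/
theorem mem_of_clear {A : Subring L} {S : Set L} (hS : ∀ p ∈ S, PrimeIn A p) {s g : L}
    (hs : s ∈ Submonoid.closure S) (hsg : s * g ∈ A)
    (h : ∀ p ∈ S, ∃ t ∈ A, ¬ DvdIn A p t ∧ t * g ∈ A) : g ∈ A := by
  induction hs using Submonoid.closure_induction_left generalizing g with
  | one => simpa using hsg
  | mul_left p hp s hs ih =>
    have hpg : p * g ∈ A := by
      refine ih (by convert hsg using 1; ring) fun q hq => ?_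
      obtain ⟨t, ht, hqt, htg⟩ := h q hq
      exact ⟨t, ht, hqt, by convert mul_mem (hS p hp).mem htg using 1; ring⟩
    obtain ⟨t, ht, hpt, htg⟩ := h p hp
    rcases (hS p hp).dvd_or_dvd t ht (p * g) hpg ⟨t * g, htg, by ring⟩ with h | ⟨c, hc, h⟩
    · exact absurd h hpt
    · rwa [mul_left_cancel₀ (hS p hp).ne_zero h]

/-- Denominators of elements of a ring given by generators. -/
theorem exists_clear {A : Subring L} {S G : Set L} (hSA : S ⊆ A)
    (hG : ∀ g ∈ G, ∃ s ∈ Submonoid.closure S, s * g ∈ A) {g : L} (hg : g ∈ Subring.closure G) :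
    ∃ s ∈ Submonoid.closure S, s * g ∈ A := by
  induction hg using Subring.closure_induction with
  | mem x hx => exact hG x hx
  | zero => exact ⟨1, one_mem _, by simp [A.zero_mem]⟩
  | one => exact ⟨1, one_mem _, by simp [A.one_mem]⟩
  | add x y _ _ hx hy =>
    obtain ⟨s, hs, hx⟩ := hx
    obtain ⟨t, ht, hy⟩ := hy
    refine ⟨s * t, mul_mem hs ht, ?_⟩
    convert add_mem (mul_mem (closure_le_subring hSA ht) hx)
      (mul_mem (closure_le_subring hSA hs) hy) using 1
    ring
  | neg x _ hx =>
    obtain ⟨s, hs, hx⟩ := hx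
    exact ⟨s, hs, by convert neg_mem hx using 1; ring⟩
  | mul x y _ _ hx hy =>
    obtain ⟨s, hs, hx⟩ := hx
    obtain ⟨t, ht, hy⟩ := hy
    refine ⟨s * t, mul_mem hs ht, ?_⟩
    convert mul_mem hx hy using 1
    ring

/-- Elements of B have denominators made of primes from S. A quotient c = a / q in B also has the
denominator q, which is prime to S, so c already lies in A. -/
theorem PrimeIn.descend {A B : Subring L} (hAB : A ≤ B) {S : Set L} (hS : ∀ p ∈ S, PrimeIn A p)
    (hB : ∀ g ∈ B, ∃ s ∈ Submonoid.closure S, s * g ∈ A) {q : L} (hqA : q ∈ A)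
    (hq : PrimeIn B q) (hSq : ∀ p ∈ S, ¬ DvdIn A p q) : PrimeIn A q := by
  have key : ∀ a ∈ A, DvdIn B q a → DvdIn A q a := by
    rintro a ha ⟨c, hc, rfl⟩
    obtain ⟨s, hs, hsc⟩ := hB c hc
    exact ⟨c, mem_of_clear hS hs hsc fun p hp => ⟨q, hqA, hSq p hp, ha⟩, rfl⟩
  refine ⟨hqA, hq.ne_zero, fun h => hq.not_dvd_one (h.mono hAB), fun a ha b hb h => ?_⟩
  exact (hq.dvd_or_dvd a (hAB ha) b (hAB hb) (h.mono hAB)).imp (key a ha) (key b hb)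

/-- After clearing the denominator s of the quotient, q divides s a in A, and q does not divide s.
-/
theorem PrimeIn.dvdIn_of_dvdIn {A B : Subring L} {S : Set L} (hSA : S ⊆ A)
    (hB : ∀ g ∈ B, ∃ s ∈ Submonoid.closure S, s * g ∈ A) {q : L} (hq : PrimeIn A q)
    (hqS : ∀ s ∈ S, ¬ DvdIn A q s) {a : L} (ha : a ∈ A) (h : DvdIn B q a) : DvdIn A q a := by
  obtain ⟨c, hc, rfl⟩ := h
  obtain ⟨s, hs, hsc⟩ := hB c hc
  have h1 : DvdIn A q (s * (q * c)) := ⟨s * c, hsc, by ring⟩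
  exact (hq.dvd_or_dvd s (closure_le_subring hSA hs) _ ha h1).resolve_left
    (hq.not_dvdIn_closure hSA hqS hs)

theorem PrimeIn.ascend {A B : Subring L} (hAB : A ≤ B) {S : Set L} (hSA : S ⊆ A)
    (hS0 : ∀ s ∈ S, s ≠ 0) (hSB : ∀ s ∈ S, s⁻¹ ∈ B)
    (hB : ∀ g ∈ B, ∃ s ∈ Submonoid.closure S, s * g ∈ A) {q : L}
    (hq : PrimeIn A q) (hqS : ∀ s ∈ S, ¬ DvdIn A q s) : PrimeIn B q := by
  have hinv : ∀ s ∈ Submonoid.closure S, s⁻¹ ∈ B := by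
    intro s hs
    induction hs using Submonoid.closure_induction with
    | mem x hx => exact hSB x hx
    | one => simp [B.one_mem]
    | mul x y _ _ hx hy => rw [mul_inv]; exact mul_mem hx hy
  refine ⟨hAB hq.mem, hq.ne_zero, fun h => hq.not_dvd_one
    (hq.dvdIn_of_dvdIn hSA hB hqS A.one_mem h), fun a ha b hb h => ?_⟩
  obtain ⟨s, hs, hsa⟩ := hB a ha
  obtain ⟨t, ht, htb⟩ := hB b hb
  have h1 : DvdIn B q ((s * a) * (t * b)) := by
    convert h.mul_left (hAB (closure_le_subring hSA (mul_mem hs ht))) using 1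
    ring
  have back : ∀ r ∈ Submonoid.closure S, ∀ c, DvdIn A q (r * c) → DvdIn B q c := by
    intro r hr c h
    convert (h.mono hAB).mul_left (hinv r hr) using 1
    rw [inv_mul_cancel_left₀ (closure_ne_zero hS0 hr)]
  exact (hq.dvd_or_dvd _ hsa _ htb (hq.dvdIn_of_dvdIn hSA hB hqS (mul_mem hsa htb) h1)).imp
    (back s hs a) (back t ht b)

/-- A divisor of a product of primes is a unit times a product of primes. -/
theorem exists_eq_unit_mul {A : Subring L} {S : Set L} (hS : ∀ p ∈ S, PrimeIn A p) {s a b : L}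
    (hs : s ∈ Submonoid.closure S) (ha : a ∈ A) (hb : b ∈ A) (hab : a * b = s) :
    ∃ u ∈ A, u⁻¹ ∈ A ∧ ∃ r ∈ Submonoid.closure S, a = u * r := by
  induction hs using Submonoid.closure_induction_left generalizing a b with
  | one => exact ⟨a, ha, by rwa [inv_eq_of_mul_eq_one_right hab], 1, one_mem _, by ring⟩
  | mul_left p hp s hs ih =>
    have hsA : s ∈ A := closure_le_subring (fun p hp => (hS p hp).mem) hs
    have hp0 := (hS p hp).ne_zero
    rcases (hS p hp).dvd_or_dvd a ha b hb ⟨s, hsA, hab⟩ with ⟨c, hc, rfl⟩ | ⟨c, hc, rfl⟩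
    · obtain ⟨u, hu, hu', r, hr, rfl⟩ := ih hc hb (mul_left_cancel₀ hp0 (by rw [← hab]; ring))
      exact ⟨u, hu, hu', p * r, mul_mem (Submonoid.subset_closure hp) hr, by ring⟩
    · exact ih ha hc (mul_left_cancel₀ hp0 (by rw [← hab]; ring))

end Subrings

/-! ### Specialization of rational functions, and the partially Laurent rings `genRing`. -/

section Specialization

open MvPolynomial

variable {ι L F : Type*} [Field L] [Field F]

/-- The graph of the specialization `x ↦ w` on the rational functions whose denominator does not
vanish at `w`. -/
def specialization (x : ι → L) (w : ι → F) : Subring (L × F) where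
  carrier := {z | ∃ p q : MvPolynomial ι ℤ, aeval w q ≠ 0 ∧
    z.1 * aeval x q = aeval x p ∧ z.2 * aeval w q = aeval w p}
  mul_mem' := by
    rintro ⟨g, h⟩ ⟨g', h'⟩ ⟨p, q, hq, h1, h2⟩ ⟨p', q', hq', h1', h2'⟩
    refine ⟨p * p', q * q', ?_, ?_, ?_⟩
    · rw [map_mul]; exact mul_ne_zero hq hq'
    · simp only [map_mul, ← h1, ← h1', Prod.mk_mul_mk]; ring
    · simp only [map_mul, ← h2, ← h2', Prod.mk_mul_mk]; ring
  one_mem' := ⟨1, 1, by simp, by simp, by simp⟩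
  add_mem' := by
    rintro ⟨g, h⟩ ⟨g', h'⟩ ⟨p, q, hq, h1, h2⟩ ⟨p', q', hq', h1', h2'⟩
    refine ⟨p * q' + p' * q, q * q', ?_, ?_, ?_⟩
    · rw [map_mul]; exact mul_ne_zero hq hq'
    · simp only [map_mul, map_add, ← h1, ← h1', Prod.mk_add_mk]; ring
    · simp only [map_mul, map_add, ← h2, ← h2', Prod.mk_add_mk]; ring
  zero_mem' := ⟨0, 1, by simp, by simp, by simp⟩
  neg_mem' := by
    rintro ⟨g, h⟩ ⟨p, q, hq, h1, h2⟩
    exact ⟨-p, q, hq, by simp [← h1], by simp [← h2]⟩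

theorem mem_specialization (x : ι → L) (w : ι → F) (v : ι) :
    (x v, w v) ∈ specialization x w := ⟨X v, 1, by simp, by simp, by simp⟩

variable {x : ι → L} {w : ι → F}

/-- Algebraic independence makes the numerator of 0 the zero polynomial. This is what makes
specialization a well defined partial map. -/
theorem specialization_eq_zero (hx : AlgebraicIndependent ℤ x) {h : F}
    (hh : (0, h) ∈ specialization x w) : h = 0 := by
  obtain ⟨p, q, hq, h1, h2⟩ := hh
  have hp : p = 0 := hx (by simpa using h1.symm)
  subst hp
  simpa [hq] using h2

theorem specialization_unique (hx : AlgebraicIndependent ℤ x) {g : L} {h h' : F}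
    (hh : (g, h) ∈ specialization x w) (hh' : (g, h') ∈ specialization x w) : h = h' := by
  have := sub_mem hh hh'
  rw [Prod.mk_sub_mk, sub_self] at this
  exact sub_eq_zero.1 (specialization_eq_zero hx this)

theorem specialization_inv (hx : AlgebraicIndependent ℤ x) (z : L × F)
    (hz : z ∈ specialization x w) (h0 : z.2 ≠ 0) : (z.1⁻¹, z.2⁻¹) ∈ specialization x w := by
  obtain ⟨g, h⟩ := z
  obtain ⟨p, q, hq, h1, h2⟩ := hz
  simp only at h0 h1 h2
  have hp : aeval w p ≠ 0 := by rw [← h2]; exact mul_ne_zero h0 hq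
  have hp' : aeval x p ≠ 0 := fun h => hp (by
    have : p = 0 := hx (by simpa using h)
    simp [this])
  have hg : g ≠ 0 := fun h => hp' (by rw [← h1, h, zero_mul])
  refine ⟨q, p, hp, ?_, ?_⟩
  · rw [← h1, inv_mul_cancel_left₀ hg]
  · rw [← h2, inv_mul_cancel_left₀ h0]

/-- The ring generated by the `x v` and by the inverses of those with `v ∈ T`. -/
def genRing (x : ι → L) (T : Set ι) : Subring L :=
  Subring.closure (Set.range x ∪ (fun v => (x v)⁻¹) '' T)

theorem mem_genRing (x : ι → L) (T : Set ι) (v : ι) : x v ∈ genRing x T :=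
  Subring.subset_closure (Or.inl ⟨v, rfl⟩)

theorem inv_mem_genRing (x : ι → L) {T : Set ι} {v : ι} (hv : v ∈ T) : (x v)⁻¹ ∈ genRing x T :=
  Subring.subset_closure (Or.inr ⟨v, hv, rfl⟩)

theorem genRing_le {T : Set ι} {A : Subring L} (h : ∀ v, x v ∈ A)
    (h' : ∀ v ∈ T, (x v)⁻¹ ∈ A) : genRing x T ≤ A := by
  refine Subring.closure_le.2 ?_
  rintro _ (⟨v, rfl⟩ | ⟨v, hv, rfl⟩)
  · exact h v
  · exact h' v hv

/-- Only generators not already invertible in A enter the denominator. This isolates f_0 or f_4 as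
the only denominators over the smaller ring. -/
theorem genRing_clear {T : Set ι} {A : Subring L} (hx0 : ∀ v, x v ≠ 0) (hA : ∀ v, x v ∈ A) {g : L}
    (hg : g ∈ genRing x T) :
    ∃ s ∈ Submonoid.closure (x '' {v | v ∈ T ∧ (x v)⁻¹ ∉ A}), s * g ∈ A := by
  refine exists_clear ?_ ?_ hg
  · rintro _ ⟨v, -, rfl⟩
    exact hA v
  · rintro _ (⟨v, rfl⟩ | ⟨v, hv, rfl⟩)
    · exact ⟨1, one_mem _, by simpa using hA v⟩
    · by_cases h : (x v)⁻¹ ∈ A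
      · exact ⟨1, one_mem _, by simpa using h⟩
      · exact ⟨x v, Submonoid.subset_closure ⟨v, ⟨hv, h⟩, rfl⟩, by
          simp [mul_inv_cancel₀ (hx0 v), A.one_mem]⟩

/-- Since no inverted variable vanishes at w, the whole ring is regular there. That the value lies
in the ring generated by w gives 2-adic integrality later. -/
theorem exists_mem_specialization (hx : AlgebraicIndependent ℤ x) {T : Set ι}
    (hw : ∀ v ∈ T, w v ≠ 0) {g : L} (hg : g ∈ genRing x T) :
    ∃ h ∈ genRing w T, (g, h) ∈ specialization x w := by
  have : genRing x T ≤ ((specialization x w ⊓ (genRing w T).comap (RingHom.snd L F)).map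
      (RingHom.fst L F)) := by
    refine genRing_le (fun v => ?_) fun v hv => ?_
    · exact ⟨(x v, w v), ⟨mem_specialization x w v, mem_genRing w T v⟩, rfl⟩
    · exact ⟨((x v)⁻¹, (w v)⁻¹), ⟨specialization_inv hx (x v, w v) (mem_specialization x w v)
        (hw v hv), inv_mem_genRing w hv⟩, rfl⟩
  obtain ⟨⟨g', h⟩, ⟨h1, h2⟩, h3⟩ := this hg
  obtain rfl : g' = g := h3
  exact ⟨h, h2, h1⟩

theorem mem_polyRing_iff {g : L} : g ∈ genRing x ∅ ↔ ∃ p : MvPolynomial ι ℤ, aeval x p = g := by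
  constructor
  · intro h
    have : genRing x ∅ ≤ (aeval (R := ℤ) x).toRingHom.range :=
      genRing_le (fun v => ⟨X v, by simp⟩) (by simp)
    exact this h
  · rintro ⟨p, rfl⟩
    induction p using MvPolynomial.induction_on with
    | C a => simp
    | add p q hp hq => rw [map_add]; exact add_mem hp hq
    | mul_X p v hp => rw [map_mul, aeval_X]; exact mul_mem hp (mem_genRing x ∅ v)

theorem primeIn_polyRing (hx : AlgebraicIndependent ℤ x) (v : ι) :
    PrimeIn (genRing x ∅) (x v) := by
  have key : ∀ p : MvPolynomial ι ℤ, DvdIn (genRing x ∅) (x v) (aeval x p) ↔ X v ∣ p := by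
    intro p
    constructor
    · rintro ⟨c, hc, h⟩
      obtain ⟨q, rfl⟩ := mem_polyRing_iff.1 hc
      exact ⟨q, hx (by simpa using h)⟩
    · rintro ⟨q, rfl⟩
      exact ⟨aeval x q, mem_polyRing_iff.2 ⟨q, rfl⟩, by simp⟩
  have hX : Prime (X v : MvPolynomial ι ℤ) := X_prime
  refine ⟨mem_genRing x ∅ v, hx.ne_zero v, fun h => ?_, fun a ha b hb h => ?_⟩
  · exact hX.not_isUnit (isUnit_iff_dvd_one.2 ((key 1).1 (by simpa using h)))
  · obtain ⟨p, rfl⟩ := mem_polyRing_iff.1 ha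
    obtain ⟨q, rfl⟩ := mem_polyRing_iff.1 hb
    rw [← map_mul, key] at h
    rw [key, key]
    exact hX.dvd_or_dvd h

theorem primeIn_genRing (hx : AlgebraicIndependent ℤ x) {T : Set ι} {v : ι} (hv : v ∉ T) :
    PrimeIn (genRing x T) (x v) := by
  have hle : genRing x ∅ ≤ genRing x T := genRing_le (mem_genRing x T) (by simp)
  refine (primeIn_polyRing hx v).ascend hle (S := x '' T) ?_ ?_ ?_ ?_ ?_
  · rintro _ ⟨u, -, rfl⟩
    exact mem_genRing x ∅ u
  · rintro _ ⟨u, -, rfl⟩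
    exact hx.ne_zero u
  · rintro _ ⟨u, hu, rfl⟩
    exact inv_mem_genRing x hu
  · intro g hg
    obtain ⟨s, hs, h⟩ := genRing_clear hx.ne_zero (mem_genRing x ∅) hg
    exact ⟨s, Submonoid.closure_mono (Set.image_mono fun v h => h.1) hs, h⟩
  · rintro _ ⟨u, hu, rfl⟩ ⟨c, hc, h⟩
    obtain ⟨q, rfl⟩ := mem_polyRing_iff.1 hc
    have : (X u : MvPolynomial ι ℤ) = X v * q := hx (by simpa using h)
    have := X_dvd_X.1 ⟨q, this⟩
    exact hv (this ▸ hu)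

/-- Units are monomials up to sign, so that a specialization of the inverted variables to `1`
sends them to `1` or `-1`. -/
theorem specialization_unit (hx : AlgebraicIndependent ℤ x) {T : Set ι} (hw : ∀ v ∈ T, w v = 1)
    {u : L} (hu0 : u ≠ 0) (hu : u ∈ genRing x T) (hu' : u⁻¹ ∈ genRing x T) {h : F}
    (hh : (u, h) ∈ specialization x w) : h = 1 ∨ h = -1 := by
  have hS : ∀ p ∈ x '' T, PrimeIn (genRing x ∅) p := by
    rintro _ ⟨v, -, rfl⟩
    exact primeIn_polyRing hx v
  have hS0 : ∀ p ∈ x '' T, p ≠ 0 := fun p hp => (hS p hp).ne_zero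
  have hmono : Submonoid.closure (x '' {v | v ∈ T ∧ (x v)⁻¹ ∉ genRing x ∅}) ≤
      Submonoid.closure (x '' T) := Submonoid.closure_mono (Set.image_mono fun v h => h.1)
  have hone : ∀ s ∈ Submonoid.closure (x '' T), (s, (1 : F)) ∈ specialization x w := by
    intro s hs
    induction hs using Submonoid.closure_induction with
    | mem s hs =>
      obtain ⟨v, hv, rfl⟩ := hs
      simpa [hw v hv] using mem_specialization x w v
    | one => exact one_mem _
    | mul s t _ _ hs ht => simpa using mul_mem hs ht
  obtain ⟨s, hs, hsu⟩ := genRing_clear hx.ne_zero (mem_genRing x ∅) hu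
  obtain ⟨t, ht, htu⟩ := genRing_clear hx.ne_zero (mem_genRing x ∅) hu'
  -- The polynomials s u and t u⁻¹ multiply to the monomial s t, so s u is a monomial times a unit
  -- of the polynomial ring over ℤ, which is 1 or -1.
  obtain ⟨v, hv, hv', r, hr, hsr⟩ := exists_eq_unit_mul hS (mul_mem (hmono hs) (hmono ht)) hsu htu
    (by field_simp)
  obtain ⟨p, rfl⟩ := mem_polyRing_iff.1 hv
  obtain ⟨q, hq⟩ := mem_polyRing_iff.1 hv'
  have hp0 : aeval x p ≠ 0 := by
    intro h0
    rw [h0, zero_mul] at hsr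
    exact mul_ne_zero (closure_ne_zero hS0 (hmono hs)) hu0 hsr
  have hpq : p * q = 1 := hx (by simp [hq, hp0])
  obtain ⟨c, hc, rfl⟩ := isUnit_iff_eq_C_of_isReduced.1 (IsUnit.of_mul_eq_one _ hpq)
  have hpair : ((c : L) * r, (c : F)) ∈ specialization x w := by
    have := mul_mem (intCast_mem (specialization x w) c) (hone r hr)
    rwa [show (c : L × F) * (r, 1) = ((c : L) * r, (c : F)) from Prod.ext rfl (mul_one _)] at this
  have h2 : (s * u, h) ∈ specialization x w := by
    simpa using mul_mem (hone s (hmono hs)) hh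
  rw [hsr] at h2
  have h3 : h = (c : F) := specialization_unique hx h2 (by simpa using hpair)
  rcases Int.isUnit_iff.1 hc with rfl | rfl
  · left; simpa using h3
  · right; simpa using h3

end Specialization

/-! ### The Laurent rings of consecutive slices and the ring between them. -/

section Rings

open MvPolynomial

variable {d : ℕ} {L F : Type*} [Field L] [Field F] (k l : Fin d → ℕ)

/-- All initial variables. -/
def initVars (d : ℕ) : Set (Var d) := {v | ∃ j n, v = Var.init j n}

/-- The initial variables without those of the first slice. -/
def lateVars (d : ℕ) : Set (Var d) := {v | ∃ j n, j ≠ 0 ∧ v = Var.init j n}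

/-- The initial variables without those of the last slice. -/
def earlyVars (d : ℕ) : Set (Var d) := {v | ∃ j n, j ≠ 3 ∧ v = Var.init j n}

theorem aeval_mem_prod {ι : Type*} (Γ : Subring (L × F)) {y : ι → L} {y' : ι → F}
    (h : ∀ v, (y v, y' v) ∈ Γ) (p : MvPolynomial ι ℤ) : (aeval y p, aeval y' p) ∈ Γ := by
  induction p using MvPolynomial.induction_on with
  | C a =>
    have : ((a : L), (a : F)) ∈ Γ := intCast_mem Γ a
    simpa using this
  | add p q hp hq => simpa using add_mem hp hq
  | mul_X p v hp => simpa using mul_mem hp (h v)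

theorem specialization_next {x : Var d → L} {w : Var d → F} (hx : AlgebraicIndependent ℤ x)
    {f₀ f₁ f₂ f₃ : Site d → L} {g₀ g₁ g₂ g₃ : Site d → F}
    (h0 : ∀ n, (f₀ n, g₀ n) ∈ specialization x w) (h1 : ∀ n, (f₁ n, g₁ n) ∈ specialization x w)
    (h2 : ∀ n, (f₂ n, g₂ n) ∈ specialization x w) (h3 : ∀ n, (f₃ n, g₃ n) ∈ specialization x w)
    (n1 : ∀ n, g₁ n ≠ 0) (n2 : ∀ n, g₂ n ≠ 0) (n3 : ∀ n, g₃ n ≠ 0) (n : Site d) :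
    (next k l (fun i => x (Var.a i)) (fun i => x (Var.b i)) f₀ f₁ f₂ f₃ n,
      next k l (fun i => w (Var.a i)) (fun i => w (Var.b i)) g₀ g₁ g₂ g₃ n) ∈
      specialization x w :=
  next_mem_prod k l _ (specialization_inv hx) (fun _ => mem_specialization x w _)
    (fun _ => mem_specialization x w _) h0 h1 h2 h3 n1 n2 n3 n

theorem specialization_iter {x : Var d → L} {w : Var d → F} (hx : AlgebraicIndependent ℤ x)
    (t : ℕ) (hw : ∀ s < t, s ≠ 0 → ∀ n, iter k l w s n ≠ 0) (n : Site d) :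
    (iter k l x t n, iter k l w t n) ∈ specialization x w := by
  induction t using Nat.strong_induction_on generalizing n with
  | _ t ih =>
    match t with
    | 0 | 1 | 2 | 3 => exact mem_specialization x w _
    | m + 4 =>
      have h : ∀ s < m + 4, ∀ n, (iter k l x s n, iter k l w s n) ∈ specialization x w :=
        fun s hs n => ih s hs (fun r hr => hw r (by omega)) n
      exact specialization_next k l hx (h m (by omega)) (h (m + 1) (by omega))
        (h (m + 2) (by omega)) (h (m + 3) (by omega)) (hw (m + 1) (by omega) (by omega))
        (hw (m + 2) (by omega) (by omega)) (hw (m + 3) (by omega) (by omega)) n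

/-- Specializing x to its own backward step w turns the shifted data into x, so a relation among the
shifted data would become a relation among the x. -/
theorem algebraicIndependent_shift_one {x : Var d → L} (hx : AlgebraicIndependent ℤ x) :
    AlgebraicIndependent ℤ (shift k l x 1) := by
  set w : Var d → L := rev (shift k l (rev x) 1)
  have hgen : ∀ v : Var d, x v ≠ 0 := hx.ne_zero
  have hw : shift k l w 1 = x := by
    funext v
    cases v with
    | init j n =>
      fin_cases j
      · rfl
      · rfl
      · rfl
      · exact congrFun (next_next k l (fun i => x (Var.a i)) (fun i => x (Var.b i))
          (f₀ := fun n => x (Var.init 3 n)) (f₁ := fun n => x (Var.init 2 n))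
          (f₂ := fun n => x (Var.init 1 n)) (f₃ := fun n => x (Var.init 0 n))
          (fun n => hgen _) (fun n => hgen _)) n
    | a i => rfl
    | b i => rfl
  have hmem : ∀ v, (shift k l x 1 v, x v) ∈ specialization x w := by
    intro v
    rw [← congrFun hw v]
    cases v with
    | init j n =>
      refine specialization_iter k l hx _ (fun s hs hs0 m => ?_) n
      have : s < 4 := by omega
      interval_cases s
      · exact absurd rfl hs0
      · exact hgen (Var.init 0 m)
      · exact hgen (Var.init 1 m)
      · exact hgen (Var.init 2 m)
    | a i => exact mem_specialization x w _
    | b i => exact mem_specialization x w _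
  refine (injective_iff_map_eq_zero _).2 fun p hp => ?_
  have h := aeval_mem_prod _ hmem p
  rw [hp] at h
  exact hx ((specialization_eq_zero hx h).trans (map_zero _).symm)

theorem algebraicIndependent_shift {x : Var d → L} (hx : AlgebraicIndependent ℤ x) (N : ℕ) :
    AlgebraicIndependent ℤ (shift k l x N) := by
  induction N with
  | zero => rwa [shift_zero]
  | succ N ih => rw [← shift_shift]; exact algebraicIndependent_shift_one k l ih

theorem iter_ne_zero {x : Var d → L} (hx : AlgebraicIndependent ℤ x) (t : ℕ) (n : Site d) :
    iter k l x t n ≠ 0 :=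
  (algebraicIndependent_shift k l hx t).ne_zero (Var.init 0 n)

/-- Time reversal of the indices. -/
def revVar : Var d → Var d
  | Var.init j n => Var.init j.rev n
  | Var.a i => Var.a i
  | Var.b i => Var.b i

theorem rev_eq_comp {E : Type*} (x : Var d → E) : rev x = x ∘ revVar := by
  funext v
  cases v <;> rfl

theorem revVar_revVar (v : Var d) : revVar (revVar v) = v := by
  cases v <;> simp [revVar]

theorem algebraicIndependent_rev {x : Var d → L} (hx : AlgebraicIndependent ℤ x) :
    AlgebraicIndependent ℤ (rev x) := by
  rw [rev_eq_comp]
  exact hx.comp _ (Function.LeftInverse.injective revVar_revVar)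

theorem genRing_rev_le (x : Var d → L) : genRing (rev x) (initVars d) ≤ genRing x (initVars d) := by
  refine genRing_le (fun v => ?_) ?_
  · rw [rev_eq_comp]; exact mem_genRing x _ _
  · rintro _ ⟨j, n, rfl⟩
    exact inv_mem_genRing x (v := Var.init j.rev n) ⟨_, _, rfl⟩

theorem genRing_rev (x : Var d → L) : genRing (rev x) (initVars d) = genRing x (initVars d) :=
  le_antisymm (genRing_rev_le x) (by simpa [rev_rev] using genRing_rev_le (rev x))

theorem genRing_late_le (x : Var d → L) : genRing x (lateVars d) ≤ genRing x (initVars d) :=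
  genRing_le (mem_genRing x _) fun _ ⟨j, n, _, h⟩ => inv_mem_genRing x ⟨j, n, h⟩

theorem genRing_early_le (x : Var d → L) : genRing x (earlyVars d) ≤ genRing x (initVars d) :=
  genRing_le (mem_genRing x _) fun _ ⟨j, n, _, h⟩ => inv_mem_genRing x ⟨j, n, h⟩

/-- The ring in which the first slice is not inverted is, after one time step, the ring in which
the last slice is not inverted. -/
theorem genRing_late_eq {x : Var d → L} (hx : AlgebraicIndependent ℤ x) :
    genRing x (lateVars d) = genRing (shift k l x 1) (earlyVars d) := by
  have hlate : ∀ (j : Fin 4) (n : Site d), j ≠ 0 →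
      (x (Var.init j n))⁻¹ ∈ genRing x (lateVars d) := fun j n hj =>
    inv_mem_genRing x ⟨j, n, hj, rfl⟩
  have hearly : ∀ (j : Fin 4) (n : Site d), j ≠ 3 →
      (shift k l x 1 (Var.init j n))⁻¹ ∈ genRing (shift k l x 1) (earlyVars d) := fun j n hj =>
    inv_mem_genRing _ ⟨j, n, hj, rfl⟩
  apply le_antisymm
  · refine genRing_le (fun v => ?_) ?_
    · cases v with
      | init j n =>
        fin_cases j
        · have h := next_next k l (fun i => x (Var.a i)) (fun i => x (Var.b i))
            (f₀ := iter k l x 0) (f₂ := iter k l x 2) (iter_ne_zero k l hx 1)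
            (iter_ne_zero k l hx 3)
          change iter k l x 0 n ∈ _
          rw [← h]
          exact next_mem k l _ (fun i => mem_genRing _ _ (Var.a i))
            (fun i => mem_genRing _ _ (Var.b i)) (fun n => mem_genRing _ _ (Var.init 3 n))
            (fun n => mem_genRing _ _ (Var.init 1 n)) (fun n => mem_genRing _ _ (Var.init 0 n))
            (fun n => hearly 2 n (by decide)) (fun n => hearly 1 n (by decide))
            (fun n => hearly 0 n (by decide)) n
        · exact mem_genRing (shift k l x 1) _ (Var.init 0 n)
        · exact mem_genRing (shift k l x 1) _ (Var.init 1 n)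
        · exact mem_genRing (shift k l x 1) _ (Var.init 2 n)
      | a i => exact mem_genRing (shift k l x 1) _ (Var.a i)
      | b i => exact mem_genRing (shift k l x 1) _ (Var.b i)
    · rintro _ ⟨j, n, hj, rfl⟩
      fin_cases j
      · exact absurd rfl hj
      · exact hearly 0 n (by decide)
      · exact hearly 1 n (by decide)
      · exact hearly 2 n (by decide)
  · refine genRing_le (fun v => ?_) ?_
    · cases v with
      | init j n =>
        fin_cases j
        · exact mem_genRing x _ (Var.init 1 n)
        · exact mem_genRing x _ (Var.init 2 n)
        · exact mem_genRing x _ (Var.init 3 n)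
        · exact next_mem k l _ (fun i => mem_genRing _ _ (Var.a i))
            (fun i => mem_genRing _ _ (Var.b i)) (fun n => mem_genRing _ _ (Var.init 0 n))
            (fun n => mem_genRing _ _ (Var.init 2 n)) (fun n => mem_genRing _ _ (Var.init 3 n))
            (fun n => hlate 1 n (by decide)) (fun n => hlate 2 n (by decide))
            (fun n => hlate 3 n (by decide)) n
      | a i => exact mem_genRing x _ (Var.a i)
      | b i => exact mem_genRing x _ (Var.b i)
    · rintro _ ⟨j, n, hj, rfl⟩
      fin_cases j
      · exact hlate 1 n (by decide)
      · exact hlate 2 n (by decide)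
      · exact hlate 3 n (by decide)
      · exact absurd rfl hj

theorem genRing_late_le_shift {x : Var d → L} (hx : AlgebraicIndependent ℤ x) :
    genRing x (lateVars d) ≤ genRing (shift k l x 1) (initVars d) := by
  rw [genRing_late_eq k l hx]
  exact genRing_early_le _

theorem iter_mem_late {x : Var d → L} (hx : AlgebraicIndependent ℤ x) {t : ℕ} (ht : t ≤ 4)
    (n : Site d) : iter k l x t n ∈ genRing x (lateVars d) := by
  interval_cases t
  · exact mem_genRing x _ (Var.init 0 n)
  · exact mem_genRing x _ (Var.init 1 n)
  · exact mem_genRing x _ (Var.init 2 n)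
  · exact mem_genRing x _ (Var.init 3 n)
  · rw [genRing_late_eq k l hx]
    exact mem_genRing (shift k l x 1) _ (Var.init 3 n)

theorem iter_inv_mem_late (x : Var d → L) {t : ℕ} (ht0 : t ≠ 0) (ht : t ≤ 3)
    (n : Site d) : (iter k l x t n)⁻¹ ∈ genRing x (lateVars d) := by
  interval_cases t
  · exact absurd rfl ht0
  · exact inv_mem_genRing x (v := Var.init 1 n) ⟨_, _, by decide, rfl⟩
  · exact inv_mem_genRing x (v := Var.init 2 n) ⟨_, _, by decide, rfl⟩
  · exact inv_mem_genRing x (v := Var.init 3 n) ⟨_, _, by decide, rfl⟩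

theorem primeIn_late_iter_zero {x : Var d → L} (hx : AlgebraicIndependent ℤ x) (n : Site d) :
    PrimeIn (genRing x (lateVars d)) (iter k l x 0 n) := by
  refine primeIn_genRing hx (v := Var.init 0 n) ?_
  rintro ⟨j, m, hj, h⟩
  injection h with h1 h2
  exact hj h1.symm

theorem primeIn_late_iter_four {x : Var d → L} (hx : AlgebraicIndependent ℤ x) (n : Site d) :
    PrimeIn (genRing x (lateVars d)) (iter k l x 4 n) := by
  rw [genRing_late_eq k l hx]
  refine primeIn_genRing (algebraicIndependent_shift k l hx 1) (v := Var.init 3 n) ?_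
  rintro ⟨j, m, hj, h⟩
  injection h with h1 h2
  exact hj h1.symm

theorem clear_iter_zero {x : Var d → L} (hx : AlgebraicIndependent ℤ x) :
    ∀ g ∈ genRing x (initVars d), ∃ s ∈ Submonoid.closure (Set.range (iter k l x 0)),
      s * g ∈ genRing x (lateVars d) := by
  intro g hg
  obtain ⟨s, hs, h⟩ := genRing_clear hx.ne_zero (mem_genRing x (lateVars d)) hg
  refine ⟨s, Submonoid.closure_mono ?_ hs, h⟩
  rintro _ ⟨_, ⟨⟨j, n, rfl⟩, hv⟩, rfl⟩
  by_cases hj : j = 0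
  · subst hj
    exact ⟨n, rfl⟩
  · exact hv (inv_mem_genRing x ⟨j, n, hj, rfl⟩) |>.elim

theorem clear_iter_four {x : Var d → L} (hx : AlgebraicIndependent ℤ x) :
    ∀ g ∈ genRing (shift k l x 1) (initVars d),
      ∃ s ∈ Submonoid.closure (Set.range (iter k l x 4)), s * g ∈ genRing x (lateVars d) := by
  intro g hg
  rw [genRing_late_eq k l hx]
  obtain ⟨s, hs, h⟩ := genRing_clear (algebraicIndependent_shift k l hx 1).ne_zero
    (mem_genRing (shift k l x 1) (earlyVars d)) hg
  refine ⟨s, Submonoid.closure_mono ?_ hs, h⟩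
  rintro _ ⟨_, ⟨⟨j, n, rfl⟩, hv⟩, rfl⟩
  by_cases hj : j = 3
  · subst hj
    exact ⟨n, rfl⟩
  · exact hv (inv_mem_genRing _ ⟨j, n, hj, rfl⟩) |>.elim

end Rings

/-! ### Two explicit solutions that tell iterates apart. -/

section Numeric

variable {d : ℕ} (k l : Fin d → ℕ)

theorem neighborProd_const {E : Type*} [CommRing E] (c : E) (n : Site d) :
    neighborProd k l (fun _ => c) n = c ^ ∑ i, (k i + l i) := by
  simp only [neighborProd, ← pow_add, Finset.prod_pow_eq_pow_sum]

theorem four_le_sum (hd : 1 ≤ d) (hk : ∀ i, 0 < k i ∧ Even (k i)) (hl : ∀ i, 0 < l i ∧ Even (l i)) :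
    4 ≤ ∑ i, (k i + l i) := by
  have two : ∀ m : ℕ, 0 < m ∧ Even m → 2 ≤ m := by
    rintro m ⟨hm, r, hr⟩
    omega
  refine le_trans ?_ (Finset.single_le_sum (f := fun i => k i + l i) (fun _ _ => Nat.zero_le _)
    (Finset.mem_univ (⟨0, hd⟩ : Fin d)))
  have := two _ (hk ⟨0, hd⟩)
  have := two _ (hl ⟨0, hd⟩)
  omega

/-- Intermediate value theorem on [1/2, 1]: at 1/2 every inverse power is at least 4, so the left
side is at least 4 d, and at 1 it is 0. -/
theorem exists_period_three_root (hd : 1 ≤ d) (hk : ∀ i, 0 < k i ∧ Even (k i))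
    (hl : ∀ i, 0 < l i ∧ Even (l i)) :
    ∃ r : ℝ, 0 < r ∧ r < 1 ∧ (1 - r) * ∑ i, ((r ^ k i)⁻¹ + (r ^ l i)⁻¹) = 4 * d := by
  have hd' : (1 : ℝ) ≤ d := by exact_mod_cast hd
  set h : ℝ → ℝ := fun r => (1 - r) * ∑ i, ((r ^ k i)⁻¹ + (r ^ l i)⁻¹) with hdef
  have hcont : ContinuousOn h (Set.Icc (1 / 2) 1) := by
    refine ContinuousOn.mul (by fun_prop) (continuousOn_finsetSum _ fun i _ => ?_)
    have hne : ∀ m : ℕ, ∀ x ∈ Set.Icc (1 / 2 : ℝ) 1, x ^ m ≠ 0 := fun m x hx =>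
      pow_ne_zero _ (by linarith [hx.1])
    exact ((continuousOn_id.pow _).inv₀ (hne _)).add ((continuousOn_id.pow _).inv₀ (hne _))
  have hhalf : ∀ m : ℕ, 0 < m ∧ Even m → (4 : ℝ) ≤ ((1 / 2 : ℝ) ^ m)⁻¹ := by
    rintro m ⟨hm, s, hs⟩
    rw [one_div, inv_pow, inv_inv]
    calc (4 : ℝ) = 2 ^ 2 := by norm_num
      _ ≤ 2 ^ m := pow_le_pow_right₀ (by norm_num) (by omega)
  have h0 : 4 * (d : ℝ) ≤ h (1 / 2) := by
    have : ∑ _i : Fin d, (8 : ℝ) ≤ ∑ i, (((1 / 2 : ℝ) ^ k i)⁻¹ + ((1 / 2 : ℝ) ^ l i)⁻¹) :=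
      Finset.sum_le_sum fun i _ => by linarith [hhalf _ (hk i), hhalf _ (hl i)]
    simp only [Finset.sum_const, Finset.card_univ, Fintype.card_fin, nsmul_eq_mul] at this
    simp only [hdef]
    linarith
  have h1 : h 1 = 0 := by simp [hdef]
  obtain ⟨r, hr, hr'⟩ := intermediate_value_Icc' (by norm_num) hcont
    (show 4 * (d : ℝ) ∈ Set.Icc (h 1) (h (1 / 2)) from ⟨by rw [h1]; positivity, h0⟩)
  refine ⟨r, by linarith [hr.1], lt_of_le_of_ne hr.2 ?_, hr'⟩
  rintro rfl
  rw [h1] at hr'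
  linarith

/-- A real solution with initial values `1` whose absolute values decrease strictly. -/
theorem exists_decreasing (hd : 1 ≤ d) (hk : ∀ i, 0 < k i ∧ Even (k i))
    (hl : ∀ i, 0 < l i ∧ Even (l i)) :
    ∃ (w : Var d → ℝ) (c : ℕ → ℝ), (∀ j n, w (Var.init j n) = 1) ∧
      (∀ t n, iter k l w t n = c t) ∧ (∀ t, c t ≠ 0) ∧ ∀ s t, 3 ≤ s → s < t → |c t| < |c s| := by
  obtain ⟨r, hr0, hr1, hr⟩ := exists_period_three_root k l hd hk hl
  have hd' : (1 : ℝ) ≤ d := by exact_mod_cast hd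
  -- With this α the forcing sum is 1 - r at ratio 1 and 2 at ratio -r, so the ratios run through
  -- the cycle 1, 1, -r.
  set α : ℝ := (1 - r) / (2 * d) with hα
  set K := ∑ i, (k i + l i) with hK
  have hK4 : 4 ≤ K := four_le_sum k l hd hk hl
  let w : Var d → ℝ := fun v => match v with
    | Var.init _ _ => 1
    | Var.a _ => α
    | Var.b _ => α
  let c : ℕ → ℝ := fun t => iter k l w t 0
  have hc : ∀ t n, iter k l w t n = c t := by
    intro t
    induction t using Nat.strong_induction_on with
    | _ t ih =>
      intro n
      match t with
      | 0 | 1 | 2 | 3 => rfl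
      | m + 4 =>
        have h : ∀ s < m + 4, iter k l w s = fun _ => c s := fun s hs => funext (ih s hs)
        simp only [c, iter]
        rw [h m (by omega), h (m + 1) (by omega), h (m + 2) (by omega), h (m + 3) (by omega)]
        simp only [next, neighborProd_const]
  have G1 : ∑ i, (α / 1 ^ k i + α / 1 ^ l i) = 1 - r := by
    simp only [one_pow, div_one, Finset.sum_const, Finset.card_univ, Fintype.card_fin,
      nsmul_eq_mul, hα]
    field_simp
    ring
  have Gr : ∑ i, (α / (-r) ^ k i + α / (-r) ^ l i) = 2 := by
    have : ∀ i, α / (-r) ^ k i + α / (-r) ^ l i = α * ((r ^ k i)⁻¹ + (r ^ l i)⁻¹) := fun i => by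
      rw [(hk i).2.neg_pow, (hl i).2.neg_pow]
      ring
    rw [Finset.sum_congr rfl fun i _ => this i, ← Finset.mul_sum, hα, div_mul_eq_mul_div, hr]
    field_simp
    norm_num
  have step : ∀ m, c (m + 2) ≠ 0 → c (m + 3) ≠ 0 →
      c (m + 4) * c (m + 2) / c (m + 3) ^ K = -(c (m + 2) * c m / c (m + 1) ^ K) +
        ∑ i, (α / (c (m + 3) * c (m + 1) / c (m + 2) ^ K) ^ k i +
          α / (c (m + 3) * c (m + 1) / c (m + 2) ^ K) ^ l i) := by
    intro m h2 h3
    have h : ∀ s, iter k l w s = fun _ => c s := fun s => funext (hc s)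
    have := ratio_next k l (fun i => w (Var.a i)) (fun i => w (Var.b i))
      (f₀ := iter k l w m) (f₁ := iter k l w (m + 1)) (f₂ := iter k l w (m + 2))
      (f₃ := iter k l w (m + 3)) (fun n => by rwa [hc]) (fun n => by rwa [hc]) 0
    change ratio k l (iter k l w (m + 2)) (iter k l w (m + 3)) (iter k l w (m + 4)) 0 = _ at this
    simpa only [ratio, h, neighborProd_const] using this
  have c0 : c 0 = 1 := rfl
  have c1 : c 1 = 1 := rfl
  have c2 : c 2 = 1 := rfl
  have c3 : c 3 = 1 := rfl
  have c4 : c 4 = -r := by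
    have := step 0 (by simp [c2]) (by simp [c3])
    simp only [c0, c1, c2, c3, zero_add, one_pow, div_one, mul_one] at this
    simp only [one_pow, div_one] at G1
    rw [G1] at this
    linarith
  -- The three alternatives are the consecutive pairs in the cycle 1, 1, -r. All ratios have
  -- absolute value at most 1, and K ≥ 2 then forces the decrease.
  have inv : ∀ m, c (m + 1) ≠ 0 ∧ c (m + 2) ≠ 0 ∧ c (m + 3) ≠ 0 ∧ c (m + 4) ≠ 0 ∧
      |c (m + 4)| < |c (m + 3)| ∧ |c (m + 3)| ≤ 1 ∧
      ((c (m + 3) * c (m + 1) / c (m + 2) ^ K = 1 ∧ c (m + 4) * c (m + 2) / c (m + 3) ^ K = 1) ∨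
       (c (m + 3) * c (m + 1) / c (m + 2) ^ K = 1 ∧ c (m + 4) * c (m + 2) / c (m + 3) ^ K = -r) ∨
       (c (m + 3) * c (m + 1) / c (m + 2) ^ K = -r ∧
          c (m + 4) * c (m + 2) / c (m + 3) ^ K = 1)) := by
    intro m
    induction m with
    | zero =>
      simp only [zero_add, c1, c2, c3, c4]
      refine ⟨one_ne_zero, one_ne_zero, one_ne_zero, by linarith, ?_, by simp, ?_⟩
      · rw [abs_neg, abs_one, abs_of_pos hr0]; exact hr1
      · right; left; simp
    | succ m ih =>
      obtain ⟨h1, h2, h3, h4, hlt, hle, hX⟩ := ih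
      have hs := step (m + 1) h3 h4
      simp only [show m + 1 + 4 = m + 5 by ring, show m + 1 + 3 = m + 4 by ring,
        show m + 1 + 2 = m + 3 by ring, show m + 1 + 1 = m + 2 by ring] at hs ⊢
      have hX' : (c (m + 4) * c (m + 2) / c (m + 3) ^ K = 1 ∧
            c (m + 5) * c (m + 3) / c (m + 4) ^ K = 1) ∨
          (c (m + 4) * c (m + 2) / c (m + 3) ^ K = 1 ∧
            c (m + 5) * c (m + 3) / c (m + 4) ^ K = -r) ∨
          (c (m + 4) * c (m + 2) / c (m + 3) ^ K = -r ∧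
            c (m + 5) * c (m + 3) / c (m + 4) ^ K = 1) := by
        rcases hX with ⟨hX, hY⟩ | ⟨hX, hY⟩ | ⟨hX, hY⟩
        · rw [hX, hY, G1] at hs
          exact Or.inr (Or.inl ⟨hY, by linarith⟩)
        · rw [hX, hY, Gr] at hs
          exact Or.inr (Or.inr ⟨hY, by linarith⟩)
        · rw [hX, hY, G1] at hs
          exact Or.inl ⟨hY, by linarith⟩
      set X := c (m + 5) * c (m + 3) / c (m + 4) ^ K with hXdef
      have hX0 : X ≠ 0 ∧ |X| ≤ 1 := by
        rcases hX' with ⟨-, h⟩ | ⟨-, h⟩ | ⟨-, h⟩ <;> rw [h]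
        · simp
        · exact ⟨by linarith, by rw [abs_neg, abs_of_pos hr0]; exact hr1.le⟩
        · simp
      have h5 : c (m + 5) = X * c (m + 4) ^ K / c (m + 3) := by
        rw [hXdef]
        field_simp
      have h4' : 0 < |c (m + 4)| := abs_pos.2 h4
      have h3' : 0 < |c (m + 3)| := abs_pos.2 h3
      refine ⟨h2, h3, h4, ?_, ?_, by linarith, hX'⟩
      · rw [h5]
        exact div_ne_zero (mul_ne_zero hX0.1 (pow_ne_zero _ h4)) h3
      · rw [h5, abs_div, abs_mul, abs_pow, div_lt_iff₀ h3']
        calc |X| * |c (m + 4)| ^ K ≤ 1 * |c (m + 4)| ^ K := by gcongr; exact hX0.2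
          _ ≤ |c (m + 4)| ^ 2 := by
            rw [one_mul]
            exact pow_le_pow_of_le_one h4'.le (by linarith) (by omega)
          _ = |c (m + 4)| * |c (m + 4)| := sq _
          _ < |c (m + 4)| * |c (m + 3)| := by gcongr
  refine ⟨w, c, fun _ _ => rfl, hc, fun t => ?_, fun s t hs hst => ?_⟩
  · match t with
    | 0 => rw [c0]; exact one_ne_zero
    | t + 1 => exact (inv t).1
  · induction t, hst using Nat.le_induction with
    | base =>
      obtain ⟨m, rfl⟩ : ∃ m, s = m + 3 := ⟨s - 3, by omega⟩
      exact (inv m).2.2.2.2.1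
    | succ t ht ih =>
      obtain ⟨m, rfl⟩ : ∃ m, t = m + 3 := ⟨t - 3, by omega⟩
      exact (inv m).2.2.2.2.1.trans ih

open Classical in
/-- A rational solution that vanishes at time `4` at a single site. -/
theorem exists_vanishing (hd : 1 ≤ d) (hk : ∀ i, 0 < k i ∧ Even (k i))
    (hl : ∀ i, 0 < l i ∧ Even (l i)) (n₀ : Site d) :
    ∃ w : Var d → ℚ, (∀ j n, w (Var.init j n) ≠ 0) ∧ iter k l w 4 n₀ = 0 ∧
      (∀ n, n ≠ n₀ → iter k l w 4 n ≠ 0) ∧ ∀ n, iter k l (rev w) 4 n ≠ 0 := by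
  have hd' : (1 : ℚ) ≤ d := by exact_mod_cast hd
  -- With parameters -1 and the other slices equal to 1, the first iterate is -f - 2 d, which
  -- vanishes exactly where f = -2 d.
  let f : Site d → ℚ := fun n => if n = n₀ then -2 * d else 1
  have hf : ∀ n, f n ≠ 0 := by
    intro n
    simp only [f]
    split_ifs
    · linarith
    · exact one_ne_zero
  let w : Var d → ℚ := fun v => match v with
    | Var.init j n => if j = 0 then f n else 1
    | Var.a _ => -1
    | Var.b _ => -1
  have h4 : ∀ n, iter k l w 4 n = -f n - 2 * d := by
    intro n
    simp only [iter, next, w, neighborProd]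
    simp
    ring
  refine ⟨w, fun j n => ?_, ?_, fun n hn => ?_, fun n => ?_⟩
  · simp only [w]
    split_ifs
    · exact hf n
    · exact one_ne_zero
  · rw [h4]
    simp [f]
  · rw [h4]
    simp only [f, if_neg hn]
    linarith
  -- Backwards, f enters the terms only through even powers, so all of them are nonpositive and the
  -- first is strictly negative.
  · have hF : 0 < neighborProd k l f n := Finset.prod_pos fun i _ =>
      mul_pos ((hk i).2.pow_pos (hf _)) ((hl i).2.pow_pos (hf _))
    have : iter k l (rev w) 4 n = -(neighborProd k l f n) - ∑ i,
        (neighborProd k l f n / f (n + e i) ^ k i + neighborProd k l f n / f (n - e i) ^ l i) := by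
      have h0 : iter k l (rev w) 0 = fun _ => 1 := funext fun n => by simp [iter, rev, w, Fin.rev]
      have h1 : iter k l (rev w) 1 = fun _ => 1 := funext fun n => by simp [iter, rev, w, Fin.rev]
      have h2 : iter k l (rev w) 2 = fun _ => 1 := funext fun n => by simp [iter, rev, w, Fin.rev]
      have h3 : iter k l (rev w) 3 = f := funext fun n => by simp [iter, rev, w, Fin.rev]
      have ha : ∀ i, rev w (Var.a i) = -1 := fun i => rfl
      have hb : ∀ i, rev w (Var.b i) = -1 := fun i => rfl
      rw [show (4 : ℕ) = 0 + 4 from rfl, iter]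
      simp only [zero_add, h0, h1, h2, h3, ha, hb, next, neighborProd_const, sub_eq_add_neg,
        ← Finset.sum_neg_distrib]
      congr 1
      · simp
      · refine Finset.sum_congr rfl fun i _ => ?_
        simp
        ring
    rw [this]
    have hs : 0 ≤ ∑ i, (neighborProd k l f n / f (n + e i) ^ k i +
        neighborProd k l f n / f (n - e i) ^ l i) := Finset.sum_nonneg fun i _ =>
      add_nonneg (div_nonneg hF.le ((hk i).2.pow_pos (hf _)).le)
        (div_nonneg hF.le ((hl i).2.pow_pos (hf _)).le)
    linarith

end Numeric

/-! ### Singularity confinement, and neighbour products at a single exceptional site. -/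

section Confinement

variable {d : ℕ} {L : Type*} [Field L] (k l : Fin d → ℕ)

theorem DvdIn.add {A : Subring L} {p g h : L} (hg : DvdIn A p g) (hh : DvdIn A p h) :
    DvdIn A p (g + h) := by
  obtain ⟨c, hc, rfl⟩ := hg
  obtain ⟨c', hc', rfl⟩ := hh
  exact ⟨c + c', add_mem hc hc', by ring⟩

theorem DvdIn.sum {ι : Type*} {A : Subring L} {p : L} (s : Finset ι) {g : ι → L}
    (hg : ∀ i ∈ s, DvdIn A p (g i)) : DvdIn A p (∑ i ∈ s, g i) :=
  Finset.sum_induction g (DvdIn A p) (fun _ _ => DvdIn.add) ⟨0, A.zero_mem, by simp⟩ hg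

/-- In O the inverse of 1 - η is congruent to 1 modulo η, hence so are its powers. -/
theorem inv_one_sub_pow_sub_one {O : Subring L} {η : L} (h1 : (1 - η)⁻¹ ∈ O)
    (h0 : 1 - η ≠ 0) (m : ℕ) : ∃ o ∈ O, ((1 - η) ^ m)⁻¹ - 1 = η * o := by
  induction m with
  | zero => exact ⟨0, O.zero_mem, by simp⟩
  | succ m ih =>
    obtain ⟨o, ho, h⟩ := ih
    refine ⟨o * (1 - η)⁻¹ + (1 - η)⁻¹, add_mem (mul_mem ho h1) h1, ?_⟩
    have h2 : (1 - η)⁻¹ = 1 + η * (1 - η)⁻¹ := by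
      field_simp
      ring
    rw [pow_succ, mul_inv]
    linear_combination (1 - η)⁻¹ * h + h2

theorem ratio_iter (x : Var d → L) (t : ℕ) (h2 : ∀ n, iter k l x (t + 2) n ≠ 0)
    (h3 : ∀ n, iter k l x (t + 3) n ≠ 0) (n : Site d) :
    ratio k l (iter k l x (t + 2)) (iter k l x (t + 3)) (iter k l x (t + 4)) n =
      -ratio k l (iter k l x t) (iter k l x (t + 1)) (iter k l x (t + 2)) n +
      ∑ i, (x (Var.a i) / ratio k l (iter k l x (t + 1)) (iter k l x (t + 2)) (iter k l x (t + 3))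
          (n + e i) ^ k i +
        x (Var.b i) / ratio k l (iter k l x (t + 1)) (iter k l x (t + 2)) (iter k l x (t + 3))
          (n - e i) ^ l i) :=
  ratio_next k l _ _ h2 h3 n

/-- Singularity confinement: if `x₄` degenerates at the single site `m` and `x₆` is close to `-x₄`
there, then `x₇` is close to `x₃`. -/
theorem confinement {O : Subring L} {c : L} (hk : ∀ i, Even (k i)) (hl : ∀ i, Even (l i))
    {a b : Fin d → L} (ha : ∀ i, DvdIn O c (a i)) (hb : ∀ i, DvdIn O c (b i))
    {x₃ x₄ x₅ x₆ x₇ : Site d → L}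
    (h5 : ∀ n, x₅ n = -x₃ n + ∑ i, (a i / x₄ (n + e i) ^ k i + b i / x₄ (n - e i) ^ l i))
    (h7 : ∀ n, x₇ n = -x₅ n + ∑ i, (a i / x₆ (n + e i) ^ k i + b i / x₆ (n - e i) ^ l i))
    {m : Site d} (h4 : ∀ n, n ≠ m → (x₄ n)⁻¹ ∈ O) (h6 : ∀ n, n ≠ m → (x₆ n)⁻¹ ∈ O) {η : L}
    (hη0 : 1 - η ≠ 0) (hη1 : (1 - η)⁻¹ ∈ O) (h64 : x₆ m = -(x₄ m) * (1 - η))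
    (hηk : ∀ i, η / x₄ m ^ k i ∈ O) (hηl : ∀ i, η / x₄ m ^ l i ∈ O) (n : Site d) :
    DvdIn O c (x₇ n - x₃ n) := by
  -- At m the even exponent removes the sign of x₆ = -x₄ (1 - η), so the two poles cancel up to a
  -- multiple of η / x₄ ^ q. At other sites both terms are regular.
  have key : ∀ q : ℕ, Even q → η / x₄ m ^ q ∈ O → ∀ p, (x₆ p ^ q)⁻¹ - (x₄ p ^ q)⁻¹ ∈ O := by
    intro q hq hηq p
    by_cases hp : p = m
    · obtain ⟨o, ho, h⟩ := inv_one_sub_pow_sub_one hη1 hη0 q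
      subst hp
      have : (x₆ p ^ q)⁻¹ - (x₄ p ^ q)⁻¹ = η / x₄ p ^ q * o := by
        rw [h64, mul_pow, hq.neg_pow, mul_inv, div_eq_mul_inv]
        linear_combination (x₄ p ^ q)⁻¹ * h
      rw [this]
      exact mul_mem hηq ho
    · rw [← inv_pow, ← inv_pow]
      exact sub_mem (pow_mem (h6 p hp) _) (pow_mem (h4 p hp) _)
  have : x₇ n - x₃ n = ∑ i, (((x₆ (n + e i) ^ k i)⁻¹ - (x₄ (n + e i) ^ k i)⁻¹) * a i +
      ((x₆ (n - e i) ^ l i)⁻¹ - (x₄ (n - e i) ^ l i)⁻¹) * b i) := by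
    rw [h7, h5, neg_add, neg_neg, add_assoc, add_sub_cancel_left, ← Finset.sum_neg_distrib,
      ← Finset.sum_add_distrib]
    refine Finset.sum_congr rfl fun i _ => ?_
    simp only [div_eq_mul_inv]
    ring
  rw [this]
  exact DvdIn.sum _ fun i _ => ((ha i).mul_left (key _ (hk i) (hηk i) _)).add
    ((hb i).mul_left (key _ (hl i) (hηl i) _))

theorem e_injective {i j : Fin d} (h : (e i : Site d) = e j) : i = j := by
  by_contra hij
  have := congrFun h i
  simp [e, hij] at this

theorem sub_e_ne_add_e (n : Site d) (i j : Fin d) : n - e j ≠ n + e i := by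
  intro h
  have h1 := congrFun h i
  have h2 : 0 ≤ (e j : Site d) i := by
    unfold e
    by_cases hij : i = j
    · subst hij; simp
    · simp [hij]
  have h3 : (e i : Site d) i = 1 := by simp [e]
  simp only [Pi.sub_apply, Pi.add_apply, h3] at h1
  omega

theorem neighborProd_mul (f g : Site d → L) (n : Site d) :
    neighborProd k l (fun m => f m * g m) n = neighborProd k l f n * neighborProd k l g n := by
  simp only [neighborProd, mul_pow, ← Finset.prod_mul_distrib]
  refine Finset.prod_congr rfl fun i _ => ?_
  ring

theorem neighborProd_div_mem_add {O : Subring L} {f : Site d → L} (hf : ∀ n, f n ∈ O)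
    (hf0 : ∀ n, f n ≠ 0) (n : Site d) (i : Fin d) :
    neighborProd k l f n / f (n + e i) ^ k i ∈ O := by
  rw [neighborProd, ← Finset.mul_prod_erase _ _ (Finset.mem_univ i), mul_assoc,
    mul_div_cancel_left₀ _ (pow_ne_zero _ (hf0 _))]
  exact mul_mem (pow_mem (hf _) _)
    (prod_mem fun j _ => mul_mem (pow_mem (hf _) _) (pow_mem (hf _) _))

theorem neighborProd_div_mem_sub {O : Subring L} {f : Site d → L} (hf : ∀ n, f n ∈ O)
    (hf0 : ∀ n, f n ≠ 0) (n : Site d) (i : Fin d) :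
    neighborProd k l f n / f (n - e i) ^ l i ∈ O := by
  rw [neighborProd, ← Finset.mul_prod_erase _ _ (Finset.mem_univ i), mul_right_comm,
    mul_div_cancel_right₀ _ (pow_ne_zero _ (hf0 _))]
  exact mul_mem (pow_mem (hf _) _)
    (prod_mem fun j _ => mul_mem (pow_mem (hf _) _) (pow_mem (hf _) _))

theorem neighborProd_inv_mem {O : Subring L} {c : L} {g : Site d → L}
    (hg : ∀ n, c * (g n)⁻¹ ∈ O) (n : Site d) :
    c ^ (∑ i, (k i + l i)) * (neighborProd k l g n)⁻¹ ∈ O := by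
  rw [← neighborProd_inv, ← neighborProd_const k l c n, ← neighborProd_mul]
  exact neighborProd_mem k l O hg n

theorem neighborProd_single_add [DecidableEq (Site d)] {E : Type*} [CommRing E] (ε : E)
    (n : Site d) (i : Fin d) :
    neighborProd k l (fun p => if p = n + e i then ε else 1) n = ε ^ k i := by
  have h : ∀ j, ((if n + e j = n + e i then ε else 1) ^ k j *
      (if n - e j = n + e i then ε else 1) ^ l j : E) = if j = i then ε ^ k i else 1 := by
    intro j
    rw [if_neg (sub_e_ne_add_e n i j), one_pow, mul_one]
    by_cases hj : j = i
    · subst hj; simp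
    · rw [if_neg hj, if_neg (fun h => hj (e_injective (add_left_cancel h))), one_pow]
  simp only [neighborProd, h, Finset.prod_ite_eq', Finset.mem_univ, if_true]

theorem neighborProd_single_sub [DecidableEq (Site d)] {E : Type*} [CommRing E] (ε : E)
    (n : Site d) (i : Fin d) :
    neighborProd k l (fun p => if p = n - e i then ε else 1) n = ε ^ l i := by
  have h : ∀ j, ((if n + e j = n - e i then ε else 1) ^ k j *
      (if n - e j = n - e i then ε else 1) ^ l j : E) = if j = i then ε ^ l i else 1 := by
    intro j
    rw [if_neg (sub_e_ne_add_e n j i).symm, one_pow, one_mul]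
    by_cases hj : j = i
    · subst hj; simp
    · rw [if_neg hj, if_neg (fun h => hj (e_injective (sub_right_injective h))), one_pow]
  simp only [neighborProd, h, Finset.prod_ite_eq', Finset.mem_univ, if_true]

end Confinement

/-! ### Bounds on 2-adic orders after a degenerate slice. -/

section Order

variable {d : ℕ} {F : Type*} [Field F] (k l : Fin d → ℕ)

open Classical in
/-- A solution with a single degenerate value `2 ^ N` at time `3`: the next three slices are not
divisible by high powers of `2`. -/
theorem iter_order_bound (hd : 1 ≤ d) (hk : ∀ i, 0 < k i ∧ Even (k i))
    (hl : ∀ i, 0 < l i ∧ Even (l i))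
    (hkl : ∀ i j, k j + 2 ≤ l i * k i ∧ l j + 2 ≤ l i * k i)
    (O : Subring F) (h2 : (2 : F) ≠ 0) (hO : ∀ o ∈ O, 1 + 2 * o ≠ 0 ∧ (1 + 2 * o)⁻¹ ∈ O)
    (m : Site d) (N : ℕ) (hN : ∑ i, (k i + l i) ≤ N) (w : Var d → F)
    (hwa : ∀ i, w (Var.a i) = 2) (hwb : ∀ i, w (Var.b i) = 2)
    (hw : ∀ j n, j ≠ 3 → w (Var.init j n) = 1)
    (hw3 : ∀ n, w (Var.init 3 n) = if n = m then 2 ^ N else 1) :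
    ∀ t, 4 ≤ t → t ≤ 6 → ∀ n, iter k l w t n ≠ 0 ∧
      2 ^ ((∑ i, (k i + l i)) * ∑ i, (k i + l i)) * (iter k l w t n)⁻¹ ∈ O := by
  set K := ∑ i, (k i + l i) with hK
  have hK4 : 4 ≤ K := four_le_sum k l hd hk hl
  have hle : ∀ i, k i + l i ≤ K := fun i =>
    Finset.single_le_sum (f := fun i => k i + l i) (fun _ _ => Nat.zero_le _) (Finset.mem_univ i)
  have O2 : (2 : F) ∈ O := ofNat_mem O 2
  set ε : F := 2 ^ N with hε
  have hε0 : ε ≠ 0 := pow_ne_zero _ h2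
  have Oε : ε ∈ O := pow_mem O2 N
  have hUp : ∀ x, DvdIn O 2 (x - 1) → x ≠ 0 ∧ x ∈ O ∧ x⁻¹ ∈ O := by
    rintro x ⟨o, ho, h⟩
    have hx : x = 1 + 2 * o := by linear_combination h
    subst hx
    exact ⟨(hO o ho).1, add_mem O.one_mem (mul_mem O2 ho), (hO o ho).2⟩
  have hUm : ∀ x, DvdIn O 2 (x + 1) → x ≠ 0 ∧ x ∈ O ∧ x⁻¹ ∈ O := by
    rintro x ⟨o, ho, h⟩
    obtain ⟨h1, h2, h3⟩ := hUp (-x) ⟨-o, neg_mem ho, by linear_combination -h⟩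
    exact ⟨neg_ne_zero.1 h1, by simpa using neg_mem h2, by simpa [inv_neg] using neg_mem h3⟩
  set f := iter k l w 3
  have hfm : f = fun p => if p = m then ε else 1 := funext fun p => hw3 p
  have hf0 : ∀ n, f n ≠ 0 := by
    intro n
    rw [hfm]
    dsimp only
    split_ifs
    exacts [hε0, one_ne_zero]
  have w0 : iter k l w 0 = fun _ => 1 := funext fun n => hw 0 n (by decide)
  have w1 : iter k l w 1 = fun _ => 1 := funext fun n => hw 1 n (by decide)
  have w2 : iter k l w 2 = fun _ => 1 := funext fun n => hw 2 n (by decide)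
  set p := iter k l w 4
  set G := neighborProd k l f with hG
  have hpn : ∀ n, p n = -G n + ∑ i, (2 * (G n / f (n + e i) ^ k i) +
      2 * (G n / f (n - e i) ^ l i)) := by
    intro n
    change next k l (fun i => w (Var.a i)) (fun i => w (Var.b i)) (iter k l w 0) (iter k l w 1)
      (iter k l w 2) f n = _
    simp only [w0, w1, w2, hwa, hwb, next, neighborProd_const, one_pow, mul_one, one_mul, div_one,
      mul_div_assoc]
    rfl
  -- the slice at time 4
  have near : ∀ n q, 2 ≤ q → G n = ε ^ q → DvdIn O 4 (p n - 2) →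
      p n ≠ 0 ∧ p n ∈ O ∧ 2 * (p n)⁻¹ ∈ O ∧ G n * (p n)⁻¹ ∈ O := by
    rintro n q hq hGn ⟨o, ho, h⟩
    have hpe : p n = 2 * (1 + 2 * o) := by linear_combination h
    have h1 := hO o ho
    have hinv : 2 * (p n)⁻¹ ∈ O := by
      rw [hpe, mul_inv, mul_inv_cancel_left₀ h2]
      exact h1.2
    refine ⟨by rw [hpe]; exact mul_ne_zero h2 h1.1, ?_, hinv, ?_⟩
    · rw [hpe]
      exact mul_mem O2 (add_mem O.one_mem (mul_mem O2 ho))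
    · obtain ⟨M, hM⟩ : ∃ M, N * q = M + 1 := ⟨N * q - 1, by
        have : 0 < N * q := Nat.mul_pos (by omega) (by omega)
        omega⟩
      have : G n * (p n)⁻¹ = 2 ^ M * (2 * (p n)⁻¹) := by
        rw [hGn, hε, ← pow_mul, hM, pow_succ]
        ring
      rw [this]
      exact mul_mem (pow_mem O2 _) hinv
  have small : ∀ q, 2 ≤ q → DvdIn O 4 (ε ^ q) := by
    intro q hq
    obtain ⟨M, hM⟩ : ∃ M, N * q = M + 2 := ⟨N * q - 2, by
      have : 4 * 2 ≤ N * q := Nat.mul_le_mul (by omega) hq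
      omega⟩
    exact ⟨2 ^ M, pow_mem O2 M, by rw [hε, ← pow_mul, hM, pow_add]; ring⟩
  have two_le : ∀ q, 0 < q ∧ Even q → 2 ≤ q := by
    rintro q ⟨hq, r, hr⟩
    omega
  have hA : ∀ n, p n ≠ 0 ∧ p n ∈ O ∧ 2 * (p n)⁻¹ ∈ O ∧ G n * (p n)⁻¹ ∈ O := by
    intro n
    by_cases hadd : ∃ i, m = n + e i
    · obtain ⟨i, hi⟩ := hadd
      have hGn : G n = ε ^ k i := by
        rw [hG, hfm, hi]
        exact neighborProd_single_add k l ε n i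
      have hs := small _ (two_le _ (hk i))
      refine near n (k i) (two_le _ (hk i)) hGn ?_
      -- Modulo 4 only the summand in which f (n + e i) ^ k i cancels G n survives, with value 2.
      -- Hence p n has order exactly 1 at a neighbour of m.
      have hterm : ∀ j, DvdIn O 4 (2 * (G n / f (n + e j) ^ k j) +
          2 * (G n / f (n - e j) ^ l j) - if j = i then 2 else 0) := by
        intro j
        have hm : f (n - e j) = 1 := by
          rw [hfm, hi]
          exact if_neg (sub_e_ne_add_e n i j)
        rw [hm, one_pow, div_one, hGn]
        by_cases hj : j = i
        · subst hj
          have : f (n + e j) = ε := by rw [hfm, hi]; exact if_pos rfl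
          rw [this, div_self (pow_ne_zero _ hε0), if_pos rfl, mul_one, add_sub_cancel_left]
          exact hs.mul_left O2
        · have : f (n + e j) = 1 := by
            rw [hfm, hi]
            exact if_neg (fun h => hj (e_injective (add_left_cancel h)))
          rw [this, one_pow, div_one, if_neg hj, sub_zero]
          exact (hs.mul_left O2).add (hs.mul_left O2)
      have hsum := DvdIn.sum Finset.univ fun j _ => hterm j
      rw [Finset.sum_sub_distrib, Finset.sum_ite_eq' Finset.univ i, if_pos (Finset.mem_univ i)]
        at hsum
      rw [hpn, hGn] at *
      have := (hs.mul_left (neg_mem O.one_mem)).add hsum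
      convert this using 1
      ring
    by_cases hsub : ∃ i, m = n - e i
    · obtain ⟨i, hi⟩ := hsub
      have hGn : G n = ε ^ l i := by
        rw [hG, hfm, hi]
        exact neighborProd_single_sub k l ε n i
      have hs := small _ (two_le _ (hl i))
      refine near n (l i) (two_le _ (hl i)) hGn ?_
      have hterm : ∀ j, DvdIn O 4 (2 * (G n / f (n + e j) ^ k j) +
          2 * (G n / f (n - e j) ^ l j) - if j = i then 2 else 0) := by
        intro j
        have hm : f (n + e j) = 1 := by
          rw [hfm, hi]
          exact if_neg (sub_e_ne_add_e n j i).symm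
        rw [hm, one_pow, div_one, hGn]
        by_cases hj : j = i
        · subst hj
          have : f (n - e j) = ε := by rw [hfm, hi]; exact if_pos rfl
          rw [this, div_self (pow_ne_zero _ hε0), if_pos rfl, mul_one, add_sub_cancel_right]
          exact hs.mul_left O2
        · have : f (n - e j) = 1 := by
            rw [hfm, hi]
            exact if_neg (fun h => hj (e_injective (sub_right_injective h)))
          rw [this, one_pow, div_one, if_neg hj, sub_zero]
          exact (hs.mul_left O2).add (hs.mul_left O2)
      have hsum := DvdIn.sum Finset.univ fun j _ => hterm j
      rw [Finset.sum_sub_distrib, Finset.sum_ite_eq' Finset.univ i, if_pos (Finset.mem_univ i)]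
        at hsum
      rw [hpn, hGn] at *
      have := (hs.mul_left (neg_mem O.one_mem)).add hsum
      convert this using 1
      ring
    · push Not at hadd hsub
      have ha : ∀ j, f (n + e j) = 1 := fun j => by
        rw [hfm]; exact if_neg (hadd j).symm
      have hb : ∀ j, f (n - e j) = 1 := fun j => by
        rw [hfm]; exact if_neg (hsub j).symm
      have hGn : G n = 1 := by simp [hG, neighborProd, ha, hb]
      -- Away from the neighbours of m the value is 4 d - 1, which is odd.
      have hp1 : p n + 1 = 2 * (2 * d) := by
        rw [hpn, hGn]
        simp only [ha, hb, one_pow, div_one, Finset.sum_const, Finset.card_univ,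
          Fintype.card_fin, nsmul_eq_mul]
        ring
      obtain ⟨h1, h2, h3⟩ := hUm (p n) ⟨2 * d, mul_mem O2 (natCast_mem O d), hp1⟩
      exact ⟨h1, h2, mul_mem O2 h3, by rw [hGn, one_mul]; exact h3⟩
  -- the slice at time 5
  set q := iter k l w 5 with hq
  -- The indices of the ratios follow `confinement`, where the degenerate slice has index 4; they
  -- exceed the slice index here by one.
  set x₆ := ratio k l (iter k l w 3) (iter k l w 4) (iter k l w 5) with hx6
  set S : Site d → F := fun n => ∑ i, (2 * (G (n + e i) * (p (n + e i))⁻¹) ^ k i +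
    2 * (G (n - e i) * (p (n - e i))⁻¹) ^ l i) with hS
  have hS2 : ∀ n, DvdIn O 2 (S n) := fun n => DvdIn.sum _ fun i _ =>
    DvdIn.add ⟨_, pow_mem (hA _).2.2.2 _, rfl⟩ ⟨_, pow_mem (hA _).2.2.2 _, rfl⟩
  have hx5 : ∀ n, ratio k l (iter k l w 2) (iter k l w 3) (iter k l w 4) n = p n / G n := by
    intro n
    simp only [ratio, w2, mul_one]
    rfl
  have hx4 : ∀ n, ratio k l (iter k l w 1) (iter k l w 2) (iter k l w 3) n = f n := by
    intro n
    simp only [ratio, w1, w2, mul_one, neighborProd_const, one_pow, div_one]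
    rfl
  have hx3 : ∀ n, ratio k l (iter k l w 0) (iter k l w 1) (iter k l w 2) n = 1 := by
    intro n
    simp only [ratio, w0, w1, w2, mul_one, neighborProd_const, one_pow, div_one]
  have hx6n : ∀ n, x₆ n = -f n + S n := by
    intro n
    have := ratio_iter k l w 1 hf0 (fun n => (hA n).1) n
    rw [hx4] at this
    rw [hx6]
    refine this.trans ?_
    simp only [hx5, hwa, hwb, hS, div_eq_mul_inv, mul_inv, inv_inv, inv_pow, mul_pow]
    congr 1
    refine Finset.sum_congr rfl fun i _ => ?_
    ring
  have hGadd : ∀ i, G (m + e i) = ε ^ l i := by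
    intro i
    rw [hG, hfm, ← neighborProd_single_sub k l ε (m + e i) i, add_sub_cancel_right]
  have hGsub : ∀ i, G (m - e i) = ε ^ k i := by
    intro i
    rw [hG, hfm, ← neighborProd_single_add k l ε (m - e i) i, sub_add_cancel]
  -- Of the u v factors ε, r cancel ε ^ r and one cancels ε. One more, which is 2 ^ N with N ≥ v,
  -- pays for the v denominators y of order at most 1. This is where the 2 in r + 2 is needed.
  have hterm : ∀ (r u v : ℕ) (y : F), r + 2 ≤ u * v → v ≤ N → 2 * y⁻¹ ∈ O →
      DvdIn O 2 (2 * (ε ^ u * y⁻¹) ^ v / ε / ε ^ r) := by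
    intro r u v y hr hv hy
    obtain ⟨M, hM⟩ : ∃ M, u * v = r + 1 + 1 + M := ⟨u * v - r - 2, by omega⟩
    obtain ⟨N', hN'⟩ : ∃ N', N = N' + v := ⟨N - v, by omega⟩
    refine ⟨2 ^ N' * ε ^ M * (2 * y⁻¹) ^ v,
      mul_mem (mul_mem (pow_mem O2 _) (pow_mem Oε _)) (pow_mem hy _), ?_⟩
    have hεv : ε = 2 ^ N' * 2 ^ v := by rw [hε, hN', pow_add]
    rw [mul_pow, ← pow_mul, hM, mul_pow 2]
    have e1 : ε ^ (r + 1 + 1 + M) = ε ^ r * ε * (2 ^ N' * 2 ^ v) * ε ^ M := by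
      rw [← hεv]; ring
    rw [e1]
    field_simp
  have hη : ∀ r, (∀ i, r + 2 ≤ l i * k i) → DvdIn O 2 (S m / ε / ε ^ r) := by
    intro r hr
    simp only [hS, Finset.sum_div, add_div]
    refine DvdIn.sum _ fun i _ => DvdIn.add ?_ ?_
    · rw [hGadd]
      exact hterm r _ _ _ (hr i) (by have := hle i; omega) (hA _).2.2.1
    · rw [hGsub]
      exact hterm r _ _ _ (by rw [mul_comm]; exact hr i) (by have := hle i; omega) (hA _).2.2.1
  have hη0 : DvdIn O 2 (S m / ε) := by
    have := hη 0 fun i => by have := (hkl i i).1; omega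
    rwa [pow_zero, div_one] at this
  have h1η := hUp (1 - S m / ε) (by
    convert hη0.mul_left (neg_mem O.one_mem) using 1
    ring)
  have hfε : f m = ε := by rw [hfm]; exact if_pos rfl
  have hx6m : x₆ m = -(f m) * (1 - S m / ε) := by
    rw [hx6n, hfε]
    field_simp
    ring
  have hx6u : ∀ n, n ≠ m → x₆ n ≠ 0 ∧ x₆ n ∈ O ∧ (x₆ n)⁻¹ ∈ O := by
    intro n hn
    refine hUm _ ?_
    have : f n = 1 := by rw [hfm]; exact if_neg hn
    rw [hx6n, this, neg_add_eq_sub, sub_add_cancel]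
    exact hS2 n
  set H := neighborProd k l p
  have hH0 : ∀ n, H n ≠ 0 := neighborProd_ne_zero k l fun n => (hA n).1
  -- At m the factor f m occurs on both sides of the formula for x₆ m and cancels, so the high power
  -- of 2 does not reach q.
  have hqn : ∀ n, ∃ u, u ≠ 0 ∧ u⁻¹ ∈ O ∧ q n = u * H n := by
    intro n
    have hx : x₆ n = q n * f n / H n := rfl
    by_cases hn : n = m
    · subst hn
      refine ⟨-(1 - S n / ε), neg_ne_zero.2 h1η.1, by rw [inv_neg]; exact neg_mem h1η.2.2, ?_⟩
      have := hf0 n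
      have := hH0 n
      rw [hx] at hx6m
      field_simp at hx6m ⊢
      linear_combination hx6m
    · have hf1 : f n = 1 := by rw [hfm]; exact if_neg hn
      obtain ⟨h1, -, h3⟩ := hx6u n hn
      refine ⟨x₆ n, h1, h3, ?_⟩
      rw [hx, hf1, mul_one, div_mul_cancel₀ _ (hH0 n)]
  have hB : ∀ n, q n ≠ 0 ∧ 2 ^ K * (q n)⁻¹ ∈ O := by
    intro n
    obtain ⟨u, hu, hu', h⟩ := hqn n
    refine ⟨by rw [h]; exact mul_ne_zero hu (hH0 n), ?_⟩
    rw [h, mul_inv, mul_left_comm]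
    exact mul_mem hu' (neighborProd_inv_mem k l (fun n => (hA n).2.2.1) n)
  -- the slice at time 6
  set x₇ := ratio k l (iter k l w 4) (iter k l w 5) (iter k l w 6)
  have hx7n : ∀ n, DvdIn O 2 (x₇ n - 1) := by
    intro n
    have := confinement k l (O := O) (c := 2) (fun i => (hk i).2) (fun i => (hl i).2)
      (a := fun i => w (Var.a i)) (b := fun i => w (Var.b i))
      (fun i => ⟨1, O.one_mem, by rw [hwa, mul_one]⟩)
      (fun i => ⟨1, O.one_mem, by rw [hwb, mul_one]⟩)
      (ratio_iter k l w 0 (fun n => by simp [w2]) hf0)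
      (ratio_iter k l w 2 (fun n => (hA n).1) (fun n => (hB n).1)) (m := m)
      (fun n hn => by
        have : f n = 1 := by rw [hfm]; exact if_neg hn
        rw [hx4, this, inv_one]
        exact O.one_mem)
      (fun n hn => (hx6u n hn).2.2) (η := S m / ε) h1η.1 h1η.2.2 (by rw [hx4]; exact hx6m)
      (fun i => by
        rw [hx4, hfε]
        obtain ⟨o, ho, h⟩ := hη (k i) fun j => (hkl j i).1
        rw [h]
        exact mul_mem O2 ho)
      (fun i => by
        rw [hx4, hfε]
        obtain ⟨o, ho, h⟩ := hη (l i) fun j => (hkl j i).2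
        rw [h]
        exact mul_mem O2 ho) n
    rwa [hx3] at this
  set J := neighborProd k l q
  have hJ0 : ∀ n, J n ≠ 0 := neighborProd_ne_zero k l fun n => (hB n).1
  have hC : ∀ n, iter k l w 6 n ≠ 0 ∧ 2 ^ (K * K) * (iter k l w 6 n)⁻¹ ∈ O := by
    intro n
    obtain ⟨h1, -, h3⟩ := hUp _ (hx7n n)
    have hx : x₇ n = iter k l w 6 n * p n / J n := rfl
    have hr : iter k l w 6 n = x₇ n * J n / p n := by
      have := hJ0 n
      have := (hA n).1
      rw [hx]
      field_simp
    refine ⟨by rw [hr]; exact div_ne_zero (mul_ne_zero h1 (hJ0 n)) (hA n).1, ?_⟩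
    have := mul_mem (mul_mem h3 (hA n).2.1) (neighborProd_inv_mem k l (fun n => (hB n).2) n)
    convert this using 1
    rw [hr, inv_div, ← pow_mul]
    field_simp
    rw [mul_comm (p n)]
  intro t ht4 ht6 n
  have hpow : ∀ M x, M ≤ K * K → 2 ^ M * x ∈ O → 2 ^ (K * K) * x ∈ O := by
    intro M x hM hx
    obtain ⟨M', hM'⟩ := Nat.exists_eq_add_of_le hM
    rw [hM', pow_add, mul_comm (2 ^ M), mul_assoc]
    exact mul_mem (pow_mem O2 _) hx
  interval_cases t
  · exact ⟨(hA n).1, hpow 1 _ (by nlinarith) (by simpa using (hA n).2.2.1)⟩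
  · exact ⟨(hB n).1, hpow K _ (by nlinarith) (hB n).2⟩
  · exact hC n

end Order

/-! ### Localization at a prime element. -/

section Local

variable {L : Type*} [Field L]

/-- The localization of a subring of a field at a prime element. -/
def localRing {A : Subring L} {p : L} (hp : PrimeIn A p) : Subring L where
  carrier := {g | ∃ t ∈ A, ¬ DvdIn A p t ∧ t * g ∈ A}
  mul_mem' := by
    rintro g h ⟨s, hs, hps, hg⟩ ⟨t, ht, hpt, hh⟩
    exact ⟨s * t, mul_mem hs ht, hp.not_dvdIn_mul hs ht hps hpt, by
      convert mul_mem hg hh using 1; ring⟩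
  one_mem' := ⟨1, A.one_mem, hp.not_dvd_one, by simp [A.one_mem]⟩
  add_mem' := by
    rintro g h ⟨s, hs, hps, hg⟩ ⟨t, ht, hpt, hh⟩
    exact ⟨s * t, mul_mem hs ht, hp.not_dvdIn_mul hs ht hps hpt, by
      convert add_mem (mul_mem ht hg) (mul_mem hs hh) using 1; ring⟩
  zero_mem' := ⟨1, A.one_mem, hp.not_dvd_one, by simp [A.zero_mem]⟩
  neg_mem' := by
    rintro g ⟨s, hs, hps, hg⟩
    exact ⟨s, hs, hps, by convert neg_mem hg using 1; ring⟩

theorem le_localRing {A : Subring L} {p : L} (hp : PrimeIn A p) : A ≤ localRing hp :=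
  fun g hg => ⟨1, A.one_mem, hp.not_dvd_one, by simpa using hg⟩

theorem inv_mem_localRing {A : Subring L} {p : L} (hp : PrimeIn A p) {t : L} (ht : t ∈ A)
    (hpt : ¬ DvdIn A p t) : t⁻¹ ∈ localRing hp := by
  have h0 : t ≠ 0 := by
    rintro rfl
    exact hpt ⟨0, A.zero_mem, by simp⟩
  exact ⟨t, ht, hpt, by rw [mul_inv_cancel₀ h0]; exact A.one_mem⟩

end Local

/-! ### Membership and non-divisibility for the first iterates. -/

section FirstIterates

variable {d : ℕ} {L : Type*} [Field L] (k l : Fin d → ℕ)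

/-- A quotient in the ring would be regular at w, so g would vanish there along with p. -/
theorem not_dvdIn_of_specialization {ι F : Type*} [Field F] {x : ι → L} {w : ι → F}
    (hx : AlgebraicIndependent ℤ x) {T : Set ι} (hw : ∀ v ∈ T, w v ≠ 0) {p g : L} {h : F}
    (hp : (p, 0) ∈ specialization x w) (hg : (g, h) ∈ specialization x w) (h0 : h ≠ 0) :
    ¬ DvdIn (genRing x T) p g := by
  rintro ⟨c, hc, rfl⟩
  obtain ⟨h', -, hh'⟩ := exists_mem_specialization hx hw hc
  have := mul_mem hp hh'
  rw [Prod.mk_mul_mk, zero_mul] at this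
  exact h0 (specialization_unique hx hg this)

open Classical in
-- Take slices 1 to 4 as data and give f_{4,m} the value 2 ^ (K² + 1) in ℚ_[2], the remaining data
-- the value 1 and the parameters the value 2. The next three slices have 2-adic order at most K²,
-- but a multiple of f_{4,m} would have a larger one.
theorem not_dvdIn_iter_of_le (hd : 1 ≤ d) (hk : ∀ i, 0 < k i ∧ Even (k i))
    (hl : ∀ i, 0 < l i ∧ Even (l i))
    (hkl : ∀ i j, k j + 2 ≤ l i * k i ∧ l j + 2 ≤ l i * k i)
    {x : Var d → L} (hx : AlgebraicIndependent ℤ x) {t : ℕ} (ht5 : 5 ≤ t) (ht7 : t ≤ 7)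
    (m n : Site d) : ¬ DvdIn (genRing x (lateVars d)) (iter k l x 4 m) (iter k l x t n) := by
  set K := ∑ i, (k i + l i) with hK
  let w : Var d → ℚ_[2] := fun v => match v with
    | Var.init j n => if j = 3 then (if n = m then 2 ^ (K * K + 1) else 1) else 1
    | Var.a _ => 2
    | Var.b _ => 2
  set O := PadicInt.subring 2
  have n2 : ‖(2 : ℚ_[2])‖ = 2⁻¹ := by simpa using Padic.norm_p (p := 2)
  have O2 : (2 : ℚ_[2]) ∈ O := ofNat_mem O 2
  have two : (2 : ℚ_[2]) ≠ 0 := two_ne_zero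
  have hO : ∀ o ∈ O, (1 : ℚ_[2]) + 2 * o ≠ 0 ∧ (1 + 2 * o)⁻¹ ∈ O := by
    intro o ho
    have ho1 : ‖o‖ ≤ 1 := ho
    have hlt : ‖2 * o‖ < ‖(1 : ℚ_[2])‖ := by
      rw [norm_mul, n2, norm_one]
      linarith
    have h1 : ‖(1 : ℚ_[2]) + 2 * o‖ = 1 := by
      rw [IsUltrametricDist.norm_add_eq_max_of_norm_ne_norm hlt.ne', max_eq_left hlt.le, norm_one]
    refine ⟨fun h => by simp [h] at h1, ?_⟩
    change ‖((1 : ℚ_[2]) + 2 * o)⁻¹‖ ≤ 1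
    rw [norm_inv, h1, inv_one]
  have key := iter_order_bound k l hd hk hl hkl O two hO m (K * K + 1) (by nlinarith) w
    (fun _ => rfl) (fun _ => rfl) (fun j n hj => if_neg hj) (fun n => if_pos rfl)
  have hearly : ∀ v ∈ earlyVars d, w v = 1 := by
    rintro _ ⟨j, n, hj, rfl⟩
    exact if_neg hj
  have hwO : ∀ v, w v ∈ O := by
    intro v
    cases v with
    | init j n =>
      simp only [w]
      split_ifs
      · exact pow_mem O2 _
      · exact O.one_mem
      · exact O.one_mem
    | a i => exact O2
    | b i => exact O2
  have hw0 : ∀ v, w v ≠ 0 := by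
    intro v
    cases v with
    | init j n =>
      simp only [w]
      split_ifs
      · exact pow_ne_zero _ two
      · exact one_ne_zero
      · exact one_ne_zero
    | a i => exact two
    | b i => exact two
  have hle : genRing w (earlyVars d) ≤ O := genRing_le hwO fun v hv => by
    rw [hearly v hv, inv_one]
    exact O.one_mem
  have hy := algebraicIndependent_shift k l hx 1
  rw [genRing_late_eq k l hx]
  rintro ⟨g, hg, h⟩
  obtain ⟨s, rfl⟩ : ∃ s, t = 1 + s := ⟨t - 1, by omega⟩
  obtain ⟨o, ho, hgo⟩ := exists_mem_specialization hy (w := w)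
    (fun v hv => by rw [hearly v hv]; exact one_ne_zero) hg
  have hs := specialization_iter k l hy s (w := w) (fun r hr _ n => by
    by_cases hr4 : 4 ≤ r
    · exact (key r hr4 (by omega) n).1
    · have : r < 4 := by omega
      interval_cases r
      · exact hw0 (Var.init 0 n)
      · exact hw0 (Var.init 1 n)
      · exact hw0 (Var.init 2 n)
      · exact hw0 (Var.init 3 n)) n
  have hp := mem_specialization (shift k l x 1) w (Var.init 3 m)
  have hmul := mul_mem hp hgo
  rw [iter_shift, h] at hs
  have heq : iter k l w s n = w (Var.init 3 m) * o := specialization_unique hy hs hmul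
  have hw3 : w (Var.init 3 m) = 2 ^ (K * K + 1) := by simp [w]
  obtain ⟨h1, h2⟩ := key s (by omega) (by omega) n
  rw [heq, hw3] at h1 h2
  have ho0 : o ≠ 0 := right_ne_zero_of_mul h1
  have h3 : (2 : ℚ_[2])⁻¹ ∈ O := by
    convert mul_mem h2 (hle ho) using 1
    rw [pow_succ]
    field_simp
    rfl
  have h4 : ‖(2 : ℚ_[2])⁻¹‖ ≤ 1 := h3
  rw [norm_inv, n2] at h4
  norm_num at h4

/-- The site n is a neighbour of n ± e_i, so the neighbour product of f₂ there contains the factor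
f₂ n, and that of f₃ at n contains the powers of f₃ in the denominator. Only f₁ must be inverted,
which covers times 5 and 6 but not 7, where f₁ is the slice f_4. -/
theorem next_mem_of_middle (A : Subring L) (hk : ∀ i, 0 < k i) (hl : ∀ i, 0 < l i)
    {a b : Fin d → L} {f₀ f₁ f₂ f₃ : Site d → L}
    (ha : ∀ i, a i ∈ A) (hb : ∀ i, b i ∈ A) (h0 : ∀ n, f₀ n ∈ A) (h2 : ∀ n, f₂ n ∈ A)
    (h3 : ∀ n, f₃ n ∈ A) (g1 : ∀ n, (f₁ n)⁻¹ ∈ A) (n2 : ∀ n, f₂ n ≠ 0) (n3 : ∀ n, f₃ n ≠ 0)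
    (n : Site d) : next k l a b f₀ f₁ f₂ f₃ n ∈ A := by
  have H2 := neighborProd_mem k l A h2
  have hpow : ∀ (q r : ℕ) (y z : L), 0 < q → 0 < r → y ≠ 0 → y ∈ A → z ∈ A → z / y ^ q ∈ A →
      z ^ r / y ∈ A := by
    intro q r y z hq hr hy hyA hzA h
    obtain ⟨q, rfl⟩ : ∃ q', q = q' + 1 := ⟨q - 1, by omega⟩
    obtain ⟨r, rfl⟩ : ∃ r', r = r' + 1 := ⟨r - 1, by omega⟩
    convert mul_mem (mul_mem h (pow_mem hyA q)) (pow_mem hzA r) using 1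
    field_simp
    ring
  refine add_mem (neg_mem ?_) (sum_mem fun i _ => add_mem ?_ ?_)
  · rw [div_eq_mul_inv, ← neighborProd_inv]
    exact mul_mem (mul_mem (neighborProd_mem k l A h3 _) (h0 _)) (neighborProd_mem k l A g1 _)
  · have e1 := hpow _ _ _ _ (hl i) (hk i) (n2 n) (h2 n) (H2 (n + e i))
      (by simpa using neighborProd_div_mem_sub k l h2 n2 (n + e i) i)
    have e2 := neighborProd_div_mem_add k l h3 n3 n i
    convert mul_mem (mul_mem (mul_mem (ha i) e2) e1) (pow_mem (g1 (n + e i)) (k i)) using 1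
    rw [inv_pow, ← div_eq_mul_inv, mul_div_assoc', mul_div_assoc', div_mul_eq_mul_div, div_div,
      div_div]
    congr 1
    ring
  · have e1 := hpow _ _ _ _ (hk i) (hl i) (n2 n) (h2 n) (H2 (n - e i))
      (by simpa using neighborProd_div_mem_add k l h2 n2 (n - e i) i)
    have e2 := neighborProd_div_mem_sub k l h3 n3 n i
    convert mul_mem (mul_mem (mul_mem (hb i) e2) e1) (pow_mem (g1 (n - e i)) (l i)) using 1
    rw [inv_pow, ← div_eq_mul_inv, mul_div_assoc', mul_div_assoc', div_mul_eq_mul_div, div_div,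
      div_div]
    congr 1
    ring

theorem iter_five_mem (hk : ∀ i, 0 < k i) (hl : ∀ i, 0 < l i) {x : Var d → L}
    (hx : AlgebraicIndependent ℤ x) (n : Site d) : iter k l x 5 n ∈ genRing x (lateVars d) :=
  next_mem_of_middle k l _ hk hl (fun i => mem_genRing x _ (Var.a i))
    (fun i => mem_genRing x _ (Var.b i)) (iter_mem_late k l hx (t := 1) (by norm_num))
    (iter_mem_late k l hx (t := 3) (by norm_num)) (iter_mem_late k l hx (t := 4) le_rfl)
    (iter_inv_mem_late k l x (t := 2) (by norm_num) (by norm_num)) (iter_ne_zero k l hx 3)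
    (iter_ne_zero k l hx 4) n

theorem iter_six_mem (hk : ∀ i, 0 < k i) (hl : ∀ i, 0 < l i) {x : Var d → L}
    (hx : AlgebraicIndependent ℤ x) (n : Site d) : iter k l x 6 n ∈ genRing x (lateVars d) :=
  next_mem_of_middle k l _ hk hl (fun i => mem_genRing x _ (Var.a i))
    (fun i => mem_genRing x _ (Var.b i)) (iter_mem_late k l hx (t := 2) (by norm_num))
    (iter_mem_late k l hx (t := 4) le_rfl) (iter_five_mem k l hk hl hx)
    (iter_inv_mem_late k l x (t := 3) (by norm_num) (by norm_num)) (iter_ne_zero k l hx 4)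
    (iter_ne_zero k l hx 5) n

theorem not_dvdIn_iter_four (hd : 1 ≤ d) (hk : ∀ i, 0 < k i ∧ Even (k i))
    (hl : ∀ i, 0 < l i ∧ Even (l i)) {x : Var d → L} (hx : AlgebraicIndependent ℤ x)
    {T : Set (Var d)} (hT : T ⊆ initVars d) (n : Site d) :
    (∀ m, ¬ DvdIn (genRing x T) (iter k l x 4 n) (iter k l x 0 m)) ∧
    (∀ m, m ≠ n → ¬ DvdIn (genRing x T) (iter k l x 4 n) (iter k l x 4 m)) ∧
    ∀ m, ¬ DvdIn (genRing x T) (iter k l x 4 n) (iter k l (rev x) 4 m) := by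
  obtain ⟨w, hw, h4, h4', hrev⟩ := exists_vanishing k l hd hk hl n
  have hwT : ∀ v ∈ T, w v ≠ 0 := by
    intro v hv
    obtain ⟨j, m, rfl⟩ := hT hv
    exact hw j m
  have spec : ∀ m, (iter k l x 4 m, iter k l w 4 m) ∈ specialization x w :=
    specialization_iter k l hx 4 fun s hs _ n => by
      interval_cases s
      exacts [hw 0 n, hw 1 n, hw 2 n, hw 3 n]
  have hp := spec n
  rw [h4] at hp
  refine ⟨fun m => ?_, fun m hm => ?_, fun m => ?_⟩
  · exact not_dvdIn_of_specialization hx hwT hp (mem_specialization x w (Var.init 0 m)) (hw 0 m)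
  · exact not_dvdIn_of_specialization hx hwT hp (spec m) (h4' m hm)
  · refine not_dvdIn_of_specialization hx hwT hp ?_ (hrev m)
    exact specialization_next k l hx (fun n => mem_specialization x w (Var.init 3 n))
      (fun n => mem_specialization x w (Var.init 2 n))
      (fun n => mem_specialization x w (Var.init 1 n))
      (fun n => mem_specialization x w (Var.init 0 n)) (hw 2) (hw 1) (hw 0) m

end FirstIterates

/-! ### The induction: Laurent property, primality, and coprimality. -/

section Main

variable {d : ℕ} {L : Type*} [Field L] {k l : Fin d → ℕ}

/-- Membership in the smaller ring can be checked locally at the primes `f_{4, m}`. -/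
theorem mem_late_of_local {x : Var d → L} (hx : AlgebraicIndependent ℤ x) {g : L}
    (hg : g ∈ genRing (shift k l x 1) (initVars d))
    (h : ∀ m, g ∈ localRing (primeIn_late_iter_four k l hx m)) : g ∈ genRing x (lateVars d) := by
  obtain ⟨s, hs, hsg⟩ := clear_iter_four k l hx g hg
  refine mem_of_clear ?_ hs hsg ?_
  · rintro _ ⟨m, rfl⟩
    exact primeIn_late_iter_four k l hx m
  · rintro _ ⟨m, rfl⟩
    exact h m

theorem iter_seven_mem_local (hd : 1 ≤ d) (hk : ∀ i, 0 < k i ∧ Even (k i))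
    (hl : ∀ i, 0 < l i ∧ Even (l i))
    (hkl : ∀ i j, k j + 2 ≤ l i * k i ∧ l j + 2 ≤ l i * k i)
    {x : Var d → L} (hx : AlgebraicIndependent ℤ x) (m n : Site d) :
    iter k l x 7 n ∈ localRing (primeIn_late_iter_four k l hx m) := by
  set C := genRing x (lateVars d)
  set O := localRing (primeIn_late_iter_four k l hx m)
  have hne := iter_ne_zero k l hx
  have hCO : C ≤ O := le_localRing _
  have mem : ∀ t, t ≤ 6 → ∀ n, iter k l x t n ∈ O := by
    intro t ht n
    by_cases h4 : t ≤ 4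
    · exact hCO (iter_mem_late k l hx h4 n)
    · obtain rfl | rfl : t = 5 ∨ t = 6 := by omega
      · exact hCO (iter_five_mem k l (fun i => (hk i).1) (fun i => (hl i).1) hx n)
      · exact hCO (iter_six_mem k l (fun i => (hk i).1) (fun i => (hl i).1) hx n)
  have inv : ∀ t, t ≠ 0 → t ≠ 4 → t ≤ 6 → ∀ n, (iter k l x t n)⁻¹ ∈ O := by
    intro t h0 h4 ht n
    by_cases h3 : t ≤ 3
    · exact hCO (iter_inv_mem_late k l x h0 h3 n)
    · have hnd := not_dvdIn_iter_of_le k l hd hk hl hkl hx (t := t) (by omega) (by omega) m n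
      obtain rfl | rfl : t = 5 ∨ t = 6 := by omega
      · exact inv_mem_localRing _
          (iter_five_mem k l (fun i => (hk i).1) (fun i => (hl i).1) hx n) hnd
      · exact inv_mem_localRing _
          (iter_six_mem k l (fun i => (hk i).1) (fun i => (hl i).1) hx n) hnd
  have hsub : lateVars d ⊆ initVars d := fun _ ⟨j, n, _, h⟩ => ⟨j, n, h⟩
  have inv4 : ∀ n, n ≠ m → (iter k l x 4 n)⁻¹ ∈ O := fun n hn =>
    inv_mem_localRing _ (iter_mem_late k l hx le_rfl n)
      ((not_dvdIn_iter_four k l hd hk hl hx hsub m).2.1 n hn)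
  have hF : ∀ t, t ≤ 6 → ∀ n, neighborProd k l (iter k l x t) n ∈ O := fun t ht =>
    neighborProd_mem k l O (mem t ht)
  have hFi : ∀ t, t ≠ 0 → t ≠ 4 → t ≤ 6 → ∀ n, (neighborProd k l (iter k l x t) n)⁻¹ ∈ O := by
    intro t h0 h4 ht n
    rw [← neighborProd_inv]
    exact neighborProd_mem k l O (inv t h0 h4 ht) n
  have hF0 : ∀ t n, neighborProd k l (iter k l x t) n ≠ 0 := fun t =>
    neighborProd_ne_zero k l (hne t)
  set x₃ := ratio k l (iter k l x 1) (iter k l x 2) (iter k l x 3)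
  set x₄ := ratio k l (iter k l x 2) (iter k l x 3) (iter k l x 4) with hx4
  set x₅ := ratio k l (iter k l x 3) (iter k l x 4) (iter k l x 5) with hx5
  set x₆ := ratio k l (iter k l x 4) (iter k l x 5) (iter k l x 6) with hx6
  set x₇ := ratio k l (iter k l x 5) (iter k l x 6) (iter k l x 7) with hx7
  set p := iter k l x 4 m with hp
  have hp0 : p ≠ 0 := hne 4 m
  set S := ∑ i, (x (Var.a i) / x₅ (m + e i) ^ k i + x (Var.b i) / x₅ (m - e i) ^ l i) with hS
  have hx46 : x₆ m = -x₄ m + S := ratio_iter k l x 2 (hne 4) (hne 5) m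
  have hx4m : (x₄ m)⁻¹ = neighborProd k l (iter k l x 3) m * (iter k l x 2 m)⁻¹ * p⁻¹ := by
    rw [hp, hx4, ratio, inv_div, div_eq_mul_inv, mul_inv]
    ring
  have hx40 : x₄ m ≠ 0 := div_ne_zero (mul_ne_zero (hne 4 m) (hne 2 m)) (hF0 3 m)
  have hη : ∀ q, (∀ i, q + 2 ≤ l i * k i) → S / x₄ m / x₄ m ^ q ∈ O := by
    intro q hq
    have hdiv : ∀ y : L, y / x₄ m / x₄ m ^ q = y * (p ^ (q + 1))⁻¹ *
        (neighborProd k l (iter k l x 3) m * (iter k l x 2 m)⁻¹) ^ (q + 1) := by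
      intro y
      rw [div_div, ← pow_succ', div_eq_mul_inv, ← inv_pow, hx4m, mul_pow, inv_pow p]
      ring
    have hO2 : (neighborProd k l (iter k l x 3) m * (iter k l x 2 m)⁻¹) ^ (q + 1) ∈ O :=
      pow_mem (mul_mem (hF 3 (by norm_num) m) (inv 2 (by norm_num) (by norm_num) (by norm_num) m)) _
    -- Since x₅ = f_5 f_3 / F_4 and F_4 contains p ^ u at a neighbour of m, the term 1 / x₅ ^ v
    -- carries p ^ (u v).
    have hterm : ∀ (u v : ℕ) (n : Site d), q + 2 ≤ u * v →
        neighborProd k l (iter k l x 4) n / p ^ u ∈ O →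
        1 / x₅ n ^ v * (p ^ (q + 1))⁻¹ ∈ O := by
      intro u v n huv hG
      obtain ⟨M, hM⟩ : ∃ M, u * v = q + 1 + M := ⟨u * v - q - 1, by omega⟩
      have : 1 / x₅ n ^ v * (p ^ (q + 1))⁻¹ =
          (neighborProd k l (iter k l x 4) n / p ^ u) ^ v * p ^ M *
            ((iter k l x 5 n)⁻¹ * (iter k l x 3 n)⁻¹) ^ v := by
        rw [div_pow, ← pow_mul, hM, hx5, ratio, div_pow, one_div_div, mul_pow, mul_pow, inv_pow,
          inv_pow]
        have := hne 5 n
        have := hne 3 n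
        field_simp
        ring
      rw [this]
      exact mul_mem (mul_mem (pow_mem hG _) (pow_mem (mem 4 (by norm_num) m) _))
        (pow_mem (mul_mem (inv 5 (by norm_num) (by norm_num) (by norm_num) n)
          (inv 3 (by norm_num) (by norm_num) (by norm_num) n)) _)
    rw [hdiv, hS, Finset.sum_mul]
    refine mul_mem (sum_mem fun i _ => ?_) hO2
    rw [add_mul, div_eq_mul_one_div, div_eq_mul_one_div (x (Var.b i)), mul_assoc, mul_assoc]
    refine add_mem (mul_mem (hCO (mem_genRing x _ _)) ?_) (mul_mem (hCO (mem_genRing x _ _)) ?_)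
    · refine hterm (l i) _ _ (hq i) ?_
      have := neighborProd_div_mem_sub k l (mem 4 (by norm_num)) (hne 4) (m + e i) i
      rwa [add_sub_cancel_right] at this
    · refine hterm (k i) _ _ (by rw [mul_comm]; exact hq i) ?_
      have := neighborProd_div_mem_add k l (mem 4 (by norm_num)) (hne 4) (m - e i) i
      rwa [sub_add_cancel] at this
  have h1η : 1 - S / x₄ m = -(x₆ m * (x₄ m)⁻¹) := by
    rw [hx46]
    field_simp
    ring
  -- The factor f_{4,m} cancels in x₆ / x₄. The inverse is regular because f_6 and f_3, being prime
  -- to f_{4,m}, are local units.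
  have h1η' : 1 - S / x₄ m = -(iter k l x 6 m * (neighborProd k l (iter k l x 5) m)⁻¹ *
      (neighborProd k l (iter k l x 3) m * (iter k l x 2 m)⁻¹)) := by
    have := hne 4 m
    rw [h1η, hx4m, hp, hx6, ratio]
    field_simp
  have hx60 : x₆ m ≠ 0 := div_ne_zero (mul_ne_zero (hne 6 m) (hne 4 m)) (hF0 5 m)
  have key := confinement k l (O := O) (c := 1) (fun i => (hk i).2) (fun i => (hl i).2)
    (a := fun i => x (Var.a i)) (b := fun i => x (Var.b i))
    (fun i => ⟨_, hCO (mem_genRing x _ (Var.a i)), (one_mul _).symm⟩)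
    (fun i => ⟨_, hCO (mem_genRing x _ (Var.b i)), (one_mul _).symm⟩)
    (ratio_iter k l x 1 (hne 3) (hne 4)) (ratio_iter k l x 3 (hne 5) (hne 6)) (m := m)
    (fun n hn => by
      change (iter k l x 4 n * iter k l x 2 n / neighborProd k l (iter k l x 3) n)⁻¹ ∈ O
      rw [inv_div, div_eq_mul_inv, mul_inv]
      exact mul_mem (hF 3 (by norm_num) n) (mul_mem (inv4 n hn)
        (inv 2 (by norm_num) (by norm_num) (by norm_num) n)))
    (fun n hn => by
      change (iter k l x 6 n * iter k l x 4 n / neighborProd k l (iter k l x 5) n)⁻¹ ∈ O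
      rw [inv_div, div_eq_mul_inv, mul_inv]
      exact mul_mem (hF 5 (by norm_num) n)
        (mul_mem (inv 6 (by norm_num) (by norm_num) (by norm_num) n) (inv4 n hn)))
    (η := S / x₄ m)
    (by rw [h1η]; exact neg_ne_zero.2 (mul_ne_zero hx60 (inv_ne_zero hx40)))
    (by
      rw [h1η', inv_neg, mul_inv, mul_inv, mul_inv, inv_inv, inv_inv]
      exact neg_mem (mul_mem (mul_mem (inv 6 (by norm_num) (by norm_num) (by norm_num) m)
        (hF 5 (by norm_num) m)) (mul_mem (hFi 3 (by norm_num) (by norm_num) (by norm_num) m)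
        (mem 2 (by norm_num) m))))
    (by
      change x₆ m = -x₄ m * _
      rw [hx46]
      field_simp
      ring)
    (fun i => hη _ fun j => (hkl j i).1) (fun i => hη _ fun j => (hkl j i).2) n
  obtain ⟨o, ho, h⟩ := key
  have hx7O : x₇ n ∈ O := by
    have h3 : x₃ n ∈ O := by
      change iter k l x 3 n * iter k l x 1 n / neighborProd k l (iter k l x 2) n ∈ O
      rw [div_eq_mul_inv]
      exact mul_mem (mul_mem (mem 3 (by norm_num) n) (mem 1 (by norm_num) n))
        (hFi 2 (by norm_num) (by norm_num) (by norm_num) n)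
    have : x₇ n = x₃ n + o := by
      change x₇ n - x₃ n = _ at h
      linear_combination h
    rw [this]
    exact add_mem h3 ho
  have : iter k l x 7 n = x₇ n * neighborProd k l (iter k l x 6) n * (iter k l x 5 n)⁻¹ := by
    have := hne 5 n
    have := hF0 6 n
    rw [hx7, ratio]
    field_simp
  rw [this]
  exact mul_mem (mul_mem hx7O (hF 6 le_rfl n))
    (inv 5 (by norm_num) (by norm_num) (by norm_num) n)

theorem iter_seven_mem (hd : 1 ≤ d) (hk : ∀ i, 0 < k i ∧ Even (k i))
    (hl : ∀ i, 0 < l i ∧ Even (l i))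
    (hkl : ∀ i j, k j + 2 ≤ l i * k i ∧ l j + 2 ≤ l i * k i)
    {x : Var d → L} (hx : AlgebraicIndependent ℤ x) (n : Site d) :
    iter k l x 7 n ∈ genRing x (lateVars d) := by
  refine mem_late_of_local (k := k) (l := l) hx ?_ fun m => iter_seven_mem_local hd hk hl hkl hx m n
  have := iter_six_mem k l (fun i => (hk i).1) (fun i => (hl i).1)
    (algebraicIndependent_shift k l hx 1) n
  rw [iter_shift] at this
  exact genRing_late_le _ this

theorem iter_eight_mem (hd : 1 ≤ d) (hk : ∀ i, 0 < k i ∧ Even (k i))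
    (hl : ∀ i, 0 < l i ∧ Even (l i))
    (hkl : ∀ i j, k j + 2 ≤ l i * k i ∧ l j + 2 ≤ l i * k i)
    {x : Var d → L} (hx : AlgebraicIndependent ℤ x) (n : Site d) :
    iter k l x 8 n ∈ genRing x (lateVars d) := by
  refine mem_late_of_local (k := k) (l := l) hx ?_ fun m => ?_
  · have := iter_seven_mem hd hk hl hkl (algebraicIndependent_shift k l hx 1) n
    rw [iter_shift] at this
    exact genRing_late_le _ this
  · have hCO := le_localRing (primeIn_late_iter_four k l hx m)
    have m5 := iter_five_mem k l (fun i => (hk i).1) (fun i => (hl i).1) hx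
    have m6 := iter_six_mem k l (fun i => (hk i).1) (fun i => (hl i).1) hx
    have m7 := iter_seven_mem hd hk hl hkl hx
    have hnd := fun t (h5 : 5 ≤ t) (h7 : t ≤ 7) n =>
      not_dvdIn_iter_of_le k l hd hk hl hkl hx h5 h7 m n
    exact next_mem k l _ (fun i => hCO (mem_genRing x _ (Var.a i)))
      (fun i => hCO (mem_genRing x _ (Var.b i)))
      (fun n => hCO (iter_mem_late k l hx (t := 4) le_rfl n))
      (fun n => hCO (m6 n)) (fun n => hCO (m7 n))
      (fun n => inv_mem_localRing _ (m5 n) (hnd 5 le_rfl (by norm_num) n))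
      (fun n => inv_mem_localRing _ (m6 n) (hnd 6 (by norm_num) (by norm_num) n))
      (fun n => inv_mem_localRing _ (m7 n) (hnd 7 (by norm_num) le_rfl n)) n

/-- A unit is a signed monomial in the initial variables, all of which take the value 1 here. -/
theorem abs_eq_of_associated {x : Var d → L} (hx : AlgebraicIndependent ℤ x) {w : Var d → ℝ}
    (hw : ∀ j n, w (Var.init j n) = 1) {g u : L} (hu0 : u ≠ 0) (hu : u ∈ genRing x (initVars d))
    (hu' : u⁻¹ ∈ genRing x (initVars d)) {c c' : ℝ} (hg : (g, c) ∈ specialization x w)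
    (hgu : (g * u, c') ∈ specialization x w) : |c'| = |c| := by
  obtain ⟨h, -, hh⟩ := exists_mem_specialization hx (T := initVars d) (w := w)
    (by rintro _ ⟨j, n, rfl⟩; rw [hw]; exact one_ne_zero) hu
  have h1 := specialization_unit hx (T := initVars d) (w := w)
    (by rintro _ ⟨j, n, rfl⟩; exact hw j n) hu0 hu hu' hh
  rw [specialization_unique hx hgu (mul_mem hg hh), abs_mul]
  rcases h1 with rfl | rfl <;> simp

/-- The claims about the iterate at time `t`: it lies in the ring in which the first slice is not
inverted, it is prime in the full Laurent ring, and it is not divisible by an iterate at time `4` if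
`t ≥ 5`. -/
structure GoodAt (k l : Fin d → ℕ) (x : Var d → L) (t : ℕ) : Prop where
  mem : ∀ n, iter k l x t n ∈ genRing x (lateVars d)
  prime : ∀ n, PrimeIn (genRing x (initVars d)) (iter k l x t n)
  not_dvd : 5 ≤ t → ∀ m n, ¬ DvdIn (genRing x (lateVars d)) (iter k l x 4 m) (iter k l x t n)

/-- Seen backwards from slices 5 to 8, f_4 is the first iterate and f_3, f_2, f_1 are the next
three. By induction f_{4,m} is prime in the Laurent ring B of slices 5 to 8 and divides none of
those three there. Clearing them from the denominator of the quotient gives divisibility of f_T by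
f_{4,m} in B, where f_T is a unit (T = 8) or a prime. -/
theorem not_dvdIn_iter_four_of_good (hd : 1 ≤ d) (hk : ∀ i, 0 < k i ∧ Even (k i))
    (hl : ∀ i, 0 < l i ∧ Even (l i)) {T : ℕ} (hT : 8 ≤ T)
    (ih : ∀ t, 4 ≤ t → t < T → ∀ x : Var d → L, AlgebraicIndependent ℤ x → GoodAt k l x t)
    {x : Var d → L} (hx : AlgebraicIndependent ℤ x) (m n : Site d) :
    ¬ DvdIn (genRing x (lateVars d)) (iter k l x 4 m) (iter k l x T n) := by
  rintro ⟨g, hg, h⟩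
  have hne := iter_ne_zero k l hx
  have hy := algebraicIndependent_shift k l hx 5
  set y := shift k l x 5 with hydef
  have hz := algebraicIndependent_rev hy
  set z := rev y
  have hzx : ∀ t, t ≤ 8 → iter k l z t = iter k l x (8 - t) := fun t ht =>
    iter_rev_shift k l hne 5 t ht
  have hBz : genRing z (initVars d) = genRing y (initVars d) := genRing_rev y
  set B := genRing z (initVars d)
  have hP : PrimeIn B (iter k l x 4 m) := by
    have := (ih 4 le_rfl (by omega) z hz).prime m
    rwa [hzx 4 (by norm_num)] at this
  have hPz : PrimeIn (genRing z (lateVars d)) (iter k l x 4 m) := by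
    have := primeIn_late_iter_four k l hz m
    rwa [hzx 4 (by norm_num)] at this
  have memB : ∀ s, 1 ≤ s → s ≤ 4 → ∀ n, iter k l x s n ∈ B := by
    intro s h1 h4 n
    have := genRing_late_le _ ((ih (8 - s) (by omega) (by omega) z hz).mem n)
    rwa [hzx _ (by omega), show 8 - (8 - s) = s by omega] at this
  have notB : ∀ s, 1 ≤ s → s ≤ 3 → ∀ n, ¬ DvdIn B (iter k l x 4 m) (iter k l x s n) := by
    intro s h1 h3 n hdvd
    have hgood := ih (8 - s) (by omega) (by omega) z hz
    have h4z := (not_dvdIn_iter_four k l hd hk hl hz (T := lateVars d)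
      (fun _ ⟨j, n, _, h⟩ => ⟨j, n, h⟩) m).1
    have hmem := hgood.mem n
    have hnot := hgood.not_dvd (by omega) m n
    rw [hzx (8 - s) (by omega), show 8 - (8 - s) = s by omega] at hmem hnot
    rw [hzx 4 (by norm_num)] at hnot h4z
    refine hnot (hPz.dvdIn_of_dvdIn ?_ (clear_iter_zero k l hz) ?_ hmem hdvd)
    · rintro _ ⟨n, rfl⟩
      exact mem_genRing z _ (Var.init 0 n)
    · rintro _ ⟨n, rfl⟩
      exact h4z n
  -- clear the denominators of `g` in `B`
  have hs1 : ∀ v, shift k l x 1 v ∈ B := by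
    intro v
    cases v with
    | init j n => exact memB (1 + j) (by omega) (by omega) n
    | a i => exact mem_genRing z _ (Var.a i)
    | b i => exact mem_genRing z _ (Var.b i)
  rw [genRing_late_eq k l hx] at hg
  obtain ⟨s, hs, hsg⟩ := genRing_clear (algebraicIndependent_shift k l hx 1).ne_zero hs1 hg
  have hsP : ¬ DvdIn B (iter k l x 4 m) s := by
    refine hP.not_dvdIn_closure ?_ ?_ hs
    · rintro _ ⟨v, -, rfl⟩
      exact hs1 v
    · rintro _ ⟨_, ⟨⟨j, n, hj, rfl⟩, -⟩, rfl⟩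
      have hj3 : (j : ℕ) ≠ 3 := fun h => hj (Fin.ext h)
      exact notB (1 + j) (by omega) (by omega) n
  have hsB : s ∈ B := closure_le_subring (by rintro _ ⟨v, -, rfl⟩; exact hs1 v) hs
  have hTy : iter k l x T n = iter k l y (T - 5) n := by
    rw [hydef, iter_shift, show 5 + (T - 5) = T by omega]
  have hTB : iter k l x T n ∈ B := by
    rw [hTy, hBz]
    obtain rfl | hT9 := hT.eq_or_lt
    · exact mem_genRing y _ (Var.init 3 n)
    · exact ((ih (T - 5) (by omega) (by omega) y hy).prime n).mem
  have hdvd : DvdIn B (iter k l x 4 m) (iter k l x T n) :=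
    (hP.dvd_or_dvd s hsB _ hTB ⟨s * g, hsg, by rw [h]; ring⟩).resolve_left hsP
  obtain rfl | hT9 := hT.eq_or_lt
  · refine hP.not_dvd_one ?_
    have : (iter k l x 8 n)⁻¹ ∈ B := by
      rw [hBz]
      exact inv_mem_genRing y (v := Var.init 3 n) ⟨_, _, rfl⟩
    have h1 := hdvd.mul_left this
    rwa [inv_mul_cancel₀ (hne 8 n)] at h1
  · rw [hTy] at hdvd
    rw [hBz] at hdvd hP
    obtain ⟨u, hu, hu', he⟩ := hP.unit_of_dvdIn
      ((ih (T - 5) (by omega) (by omega) y hy).prime n) hdvd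
    have hu0 : u ≠ 0 := by
      rintro rfl
      rw [mul_zero] at he
      exact iter_ne_zero k l hy _ _ he
    have hPz' : iter k l x 4 m = iter k l z 4 m := by rw [hzx 4 (by norm_num)]
    -- For T = 9 both primes are one step away from the same data, one forwards and one backwards,
    -- so the decreasing solution gives them equal values; the vanishing solution separates them.
    by_cases hT9' : T = 9
    · subst hT9'
      refine (not_dvdIn_iter_four k l hd hk hl hy (T := initVars d) subset_rfl n).2.2 m
        ⟨u⁻¹, hu', ?_⟩
      change iter k l y 4 n = _ at he
      rw [he, hPz', mul_inv_cancel_right₀ hu0]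
    · obtain ⟨w, c, hw, hwc, hc0, hlt⟩ := exists_decreasing k l hd hk hl
      have h1 := specialization_iter k l hy (w := w) (T - 5)
        (fun s _ _ n => by rw [hwc]; exact hc0 s) n
      -- Data equal to 1 are symmetric under time reversal, so the backward step has the value c 4
      -- too.
      have hrevw : iter k l w 4 m = next k l (fun i => w (Var.a i)) (fun i => w (Var.b i))
          (fun n => w (Var.init 3 n)) (fun n => w (Var.init 2 n)) (fun n => w (Var.init 1 n))
          (fun n => w (Var.init 0 n)) m := by
        simp only [iter, hw]
      have h2 : (iter k l z 4 m, iter k l w 4 m) ∈ specialization y w := by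
        rw [hrevw]
        exact specialization_next k l hy (fun n => mem_specialization y w (Var.init 3 n))
          (fun n => mem_specialization y w (Var.init 2 n))
          (fun n => mem_specialization y w (Var.init 1 n))
          (fun n => mem_specialization y w (Var.init 0 n)) (fun n => by simp [hw])
          (fun n => by simp [hw]) (fun n => by simp [hw]) m
      rw [he, hwc, hPz'] at h1
      rw [hwc] at h2
      have := abs_eq_of_associated hy hw hu0 hu hu' h2 h1
      exact (hlt 4 (T - 5) (by norm_num) (by omega)).ne this

theorem goodAt (hd : 1 ≤ d) (hk : ∀ i, 0 < k i ∧ Even (k i))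
    (hl : ∀ i, 0 < l i ∧ Even (l i))
    (hkl : ∀ i j, k j + 2 ≤ l i * k i ∧ l j + 2 ≤ l i * k i)
    (t : ℕ) (ht : 4 ≤ t) : ∀ x : Var d → L, AlgebraicIndependent ℤ x → GoodAt k l x t := by
  induction t using Nat.strong_induction_on with
  | _ t ih =>
    intro x hx
    have hsub : lateVars d ⊆ initVars d := fun _ ⟨j, n, _, h⟩ => ⟨j, n, h⟩
    have hS0 : Set.range (iter k l x 0) ⊆ genRing x (lateVars d) := by
      rintro _ ⟨n, rfl⟩
      exact mem_genRing x _ (Var.init 0 n)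
    have ascend : ∀ q, PrimeIn (genRing x (lateVars d)) q →
        (∀ m, ¬ DvdIn (genRing x (lateVars d)) q (iter k l x 0 m)) →
        PrimeIn (genRing x (initVars d)) q := by
      intro q hq h
      refine hq.ascend (genRing_late_le x) hS0 ?_ ?_ (clear_iter_zero k l hx) ?_
      · rintro _ ⟨n, rfl⟩
        exact iter_ne_zero k l hx 0 n
      · rintro _ ⟨n, rfl⟩
        exact inv_mem_genRing x (v := Var.init 0 n) ⟨_, _, rfl⟩
      · rintro _ ⟨n, rfl⟩
        exact h n
    obtain rfl | ht5 := ht.eq_or_lt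
    · exact ⟨fun n => iter_mem_late k l hx le_rfl n, fun n => ascend _
        (primeIn_late_iter_four k l hx n) (not_dvdIn_iter_four k l hd hk hl hx hsub n).1,
        fun h => by omega⟩
    have hx1 := algebraicIndependent_shift k l hx 1
    have hprev := ih (t - 1) (by omega) (by omega) _ hx1
    have hshift : iter k l (shift k l x 1) (t - 1) = iter k l x t := by
      rw [iter_shift, show 1 + (t - 1) = t by omega]
    have hprime : ∀ n, PrimeIn (genRing (shift k l x 1) (initVars d)) (iter k l x t n) := by
      intro n
      rw [← hshift]
      exact hprev.prime n
    have hmem : ∀ n, iter k l x t n ∈ genRing x (lateVars d) := by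
      intro n
      -- From here on f_t is Laurent in slices 5 to 8, all of which lie in the ring and are not
      -- divisible by f_{4,m}.
      by_cases ht9 : 9 ≤ t
      · refine mem_late_of_local (k := k) (l := l) hx (hprime n).mem fun m => ?_
        have hp := primeIn_late_iter_four k l hx m
        have hy := algebraicIndependent_shift k l hx 5
        have hyC : ∀ v, shift k l x 5 v ∈ genRing x (lateVars d) := by
          intro v
          cases v with
          | init j n => exact (ih (5 + j) (by omega) (by omega) x hx).mem n
          | a i => exact mem_genRing x _ (Var.a i)
          | b i => exact mem_genRing x _ (Var.b i)
        have hg := ((ih (t - 5) (by omega) (by omega) _ hy).prime n).mem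
        rw [iter_shift, show 5 + (t - 5) = t by omega] at hg
        obtain ⟨s, hs, hsg⟩ := genRing_clear hy.ne_zero hyC hg
        refine ⟨s, closure_le_subring (by rintro _ ⟨v, -, rfl⟩; exact hyC v) hs,
          hp.not_dvdIn_closure (by rintro _ ⟨v, -, rfl⟩; exact hyC v) ?_ hs, hsg⟩
        rintro _ ⟨_, ⟨⟨j, n, rfl⟩, -⟩, rfl⟩
        exact (ih (5 + j) (by omega) (by omega) x hx).not_dvd (by omega) m n
      · obtain rfl | rfl | rfl | rfl : t = 5 ∨ t = 6 ∨ t = 7 ∨ t = 8 := by omega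
        · exact iter_five_mem k l (fun i => (hk i).1) (fun i => (hl i).1) hx n
        · exact iter_six_mem k l (fun i => (hk i).1) (fun i => (hl i).1) hx n
        · exact iter_seven_mem hd hk hl hkl hx n
        · exact iter_eight_mem hd hk hl hkl hx n
    have hnot : ∀ m n, ¬ DvdIn (genRing x (lateVars d)) (iter k l x 4 m) (iter k l x t n) := by
      intro m n
      by_cases ht8 : 8 ≤ t
      · exact not_dvdIn_iter_four_of_good hd hk hl ht8
          (fun s h4 hs x hx => ih s hs h4 x hx) hx m n
      · exact not_dvdIn_iter_of_le k l hd hk hl hkl hx (by omega) (by omega) m n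
    refine ⟨hmem, fun n => ?_, fun _ => hnot⟩
    have hlate : PrimeIn (genRing x (lateVars d)) (iter k l x t n) := by
      refine PrimeIn.descend (genRing_late_le_shift k l hx) ?_ (clear_iter_four k l hx) (hmem n)
        (hprime n) ?_
      · rintro _ ⟨m, rfl⟩
        exact primeIn_late_iter_four k l hx m
      · rintro _ ⟨m, rfl⟩
        exact hnot m n
    refine ascend _ hlate fun m hdvd => ?_
    obtain ⟨u, hu, hu', he⟩ := hlate.unit_of_dvdIn (primeIn_late_iter_zero k l hx m) hdvd
    have hu0 : u ≠ 0 := by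
      rintro rfl
      rw [mul_zero] at he
      exact iter_ne_zero k l hx _ _ he
    -- An associate of f_{0,m} would take a value of absolute value 1 = |c 3|, whereas |c t| is
    -- smaller.
    obtain ⟨w, c, hw, hwc, hc0, hlt⟩ := exists_decreasing k l hd hk hl
    have h1 := specialization_iter k l hx (w := w) t
      (fun s _ _ n => by rw [hwc]; exact hc0 s) n
    have h2 := mem_specialization x w (Var.init 0 m)
    change (iter k l x 0 m, _) ∈ _ at h2
    rw [he, hw] at h2
    rw [hwc] at h1
    have := abs_eq_of_associated hx hw hu0 (genRing_late_le x hu) (genRing_late_le x hu') h1 h2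
    have h3 : |c 3| = 1 := by
      rw [← hwc 3 0]
      simp [iter, hw]
    have := hlt 3 t le_rfl (by omega)
    rw [abs_one] at *
    linarith

/-- At different times the decreasing solution rules out associated primes. At equal times
divisibility passes through the smaller ring to the Laurent ring of the data shifted by one, until
time 4 is reached, where the vanishing solution decides. -/
theorem not_dvdIn_iter_of_ne (hd : 1 ≤ d) (hk : ∀ i, 0 < k i ∧ Even (k i))
    (hl : ∀ i, 0 < l i ∧ Even (l i))
    (hkl : ∀ i j, k j + 2 ≤ l i * k i ∧ l j + 2 ≤ l i * k i)
    {t s : ℕ} (ht : 4 ≤ t) (hs : 4 ≤ s) {n m : Site d} (hne : (t, n) ≠ (s, m)) {x : Var d → L}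
    (hx : AlgebraicIndependent ℤ x) :
    ¬ DvdIn (genRing x (initVars d)) (iter k l x t n) (iter k l x s m) := by
  by_cases hts : t = s
  · subst hts
    have hmn : m ≠ n := fun h => hne (by rw [h])
    clear hne hs
    induction t, ht using Nat.le_induction generalizing x with
    | base => exact (not_dvdIn_iter_four k l hd hk hl hx subset_rfl n).2.1 m hmn
    | succ t ht ih =>
      intro hdvd
      have hx1 := algebraicIndependent_shift k l hx 1
      have hgood := goodAt hd hk hl hkl (t + 1) (by omega) x hx
      have hshift : iter k l (shift k l x 1) t = iter k l x (t + 1) := by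
        rw [iter_shift, add_comm]
      have hgood1 := (goodAt hd hk hl hkl t ht _ hx1).prime n
      rw [hshift] at hgood1
      have hlate : PrimeIn (genRing x (lateVars d)) (iter k l x (t + 1) n) := by
        refine PrimeIn.descend (genRing_late_le_shift k l hx) ?_ (clear_iter_four k l hx)
          (hgood.mem n) hgood1 ?_
        · rintro _ ⟨m, rfl⟩
          exact primeIn_late_iter_four k l hx m
        · rintro _ ⟨m, rfl⟩
          exact hgood.not_dvd (by omega) m n
      have := hlate.dvdIn_of_dvdIn (S := Set.range (iter k l x 0))
        (by rintro _ ⟨n, rfl⟩; exact mem_genRing x _ (Var.init 0 n)) (clear_iter_zero k l hx)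
        (by
          rintro _ ⟨p, rfl⟩ h
          refine (hgood.prime n).not_dvd_one ?_
          have h1 := (h.mono (genRing_late_le x)).mul_left
            (inv_mem_genRing x (T := initVars d) (v := Var.init 0 p) ⟨_, _, rfl⟩)
          change DvdIn _ _ ((iter k l x 0 p)⁻¹ * _) at h1
          rwa [inv_mul_cancel₀ (iter_ne_zero k l hx 0 p)] at h1) (hgood.mem m) hdvd
      refine ih hx1 ?_
      rw [hshift]
      exact this.mono (genRing_late_le_shift k l hx)
  · intro hdvd
    obtain ⟨u, hu, hu', he⟩ := ((goodAt hd hk hl hkl t ht x hx).prime n).unit_of_dvdIn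
      ((goodAt hd hk hl hkl s hs x hx).prime m) hdvd
    have hu0 : u ≠ 0 := by
      rintro rfl
      rw [mul_zero] at he
      exact iter_ne_zero k l hx _ _ he
    obtain ⟨w, c, hw, hwc, hc0, hlt⟩ := exists_decreasing k l hd hk hl
    have spec := fun t n => specialization_iter k l hx (w := w) t
      (fun s _ _ n => by rw [hwc]; exact hc0 s) n
    have h1 := spec t n
    have h2 := spec s m
    rw [he, hwc] at h2
    rw [hwc] at h1
    have heq := abs_eq_of_associated hx hw hu0 hu hu' h1 h2
    rcases lt_or_gt_of_ne hts with h | h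
    · exact (hlt t s (by omega) h).ne heq
    · exact (hlt s t (by omega) h).ne heq.symm

end Main

/-! ### Translation to the Laurent ring and the iterates of the statement. -/

section LaurentRing

variable {d : ℕ}

/-- The ℤ-algebra structure is named because the results over a general field use the canonical one
of a ring, while the fraction ring also inherits one from the polynomial ring; they agree as
ℤ-algebra structures are unique. -/
theorem algebraicIndependent_gen :
    @AlgebraicIndependent (Var d) ℤ (RatFun d) gen _ _ (Ring.toIntAlgebra _) := by
  have h : AlgebraicIndependent ℤ (MvPolynomial.X : Var d → MvPolynomial (Var d) ℤ) :=
    MvPolynomial.algebraicIndependent_X (Var d) ℤ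
  have h' := h.map' (f := (Algebra.ofId (MvPolynomial (Var d) ℤ) (RatFun d)).restrictScalars ℤ)
    (IsFractionRing.injective (MvPolynomial (Var d) ℤ) (RatFun d))
  convert! h' using 1
  exact Subsingleton.elim _ _

theorem mem_laurentRing_iff {g : RatFun d} :
    g ∈ laurentRing d ↔ g ∈ genRing (gen (d := d)) (initVars d) := by
  constructor
  · intro h
    refine Algebra.adjoin_induction ?_ (fun r => ?_) (fun _ _ _ _ => add_mem)
      (fun _ _ _ _ => mul_mem) h
    · rintro _ (⟨s, n, rfl | rfl⟩ | ⟨i, rfl | rfl⟩)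
      · exact mem_genRing _ _ (Var.init s n)
      · exact inv_mem_genRing _ (v := Var.init s n) ⟨s, n, rfl⟩
      · exact mem_genRing _ _ (Var.a i)
      · exact mem_genRing _ _ (Var.b i)
    · rw [eq_intCast]
      exact intCast_mem _ r
  · intro h
    have hle : genRing (gen (d := d)) (initVars d) ≤ (laurentRing d).toSubring := by
      refine genRing_le (fun v => Algebra.subset_adjoin ?_) ?_
      · cases v with
        | init s n => exact Or.inl ⟨s, n, Or.inl rfl⟩
        | a i => exact Or.inr ⟨i, Or.inl rfl⟩
        | b i => exact Or.inr ⟨i, Or.inr rfl⟩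
      · rintro _ ⟨s, n, rfl⟩
        exact Algebra.subset_adjoin (Or.inl ⟨s, n, Or.inr rfl⟩)
    exact hle h

theorem dvd_iff_dvdIn (p g : laurentRing d) :
    p ∣ g ↔ DvdIn (genRing (gen (d := d)) (initVars d)) (p : RatFun d) g := by
  constructor
  · rintro ⟨c, rfl⟩
    exact ⟨c, mem_laurentRing_iff.1 c.2, rfl⟩
  · rintro ⟨c, hc, h⟩
    exact ⟨⟨c, mem_laurentRing_iff.2 hc⟩, Subtype.ext h⟩

theorem PrimeIn.irreducible {p : laurentRing d}
    (hp : PrimeIn (genRing (gen (d := d)) (initVars d)) (p : RatFun d)) : Irreducible p := by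
  refine Prime.irreducible ⟨fun h => hp.ne_zero (congrArg Subtype.val h), fun h => ?_,
    fun a b h => ?_⟩
  · exact hp.not_dvd_one ((dvd_iff_dvdIn p 1).1 h.dvd)
  · rw [dvd_iff_dvdIn] at h ⊢
    rw [dvd_iff_dvdIn]
    exact hp.dvd_or_dvd a (mem_laurentRing_iff.1 a.2) b (mem_laurentRing_iff.1 b.2) h

theorem tau_eq_iter (k l : Fin d → ℕ) (t : ℤ) (n : Site d) :
    tau k l t n = iter k l (gen (d := d)) (t + 4).toNat n := by
  rw [tau, slice_eq_iter]

theorem isUnit_of_lt_four (k l : Fin d → ℕ) {t : ℕ} (ht : t < 4) {n : Site d} {p : laurentRing d}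
    (hp : (p : RatFun d) = iter k l (gen (d := d)) t n) : IsUnit p := by
  obtain ⟨j, hj⟩ : ∃ j : Fin 4, iter k l (gen (d := d)) t n = gen (Var.init j n) := by
    interval_cases t
    exacts [⟨0, rfl⟩, ⟨1, rfl⟩, ⟨2, rfl⟩, ⟨3, rfl⟩]
  have hmem : (gen (Var.init j n))⁻¹ ∈ laurentRing d :=
    mem_laurentRing_iff.2 (inv_mem_genRing _ ⟨j, n, rfl⟩)
  refine IsUnit.of_mul_eq_one ⟨_, hmem⟩ (Subtype.ext ?_)
  change (p : RatFun d) * (gen (Var.init j n))⁻¹ = 1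
  have h0 := iter_ne_zero k l algebraicIndependent_gen t n
  rw [hj] at h0
  rw [hp, hj, mul_inv_cancel₀ h0]

end LaurentRing

end TauKdV

theorem mainTheorem1 (d : ℕ) (hd : 1 ≤ d) (k l : Fin d → ℕ)
    (hk : ∀ i, 0 < k i ∧ Even (k i)) (hl : ∀ i, 0 < l i ∧ Even (l i))
    (hkl : ∀ i j, max (l j : ℤ) (k j) < (l i : ℤ) * k i - 1) :
    ∃ hR : ∀ (t : ℤ) (n : Fin d → ℤ), -4 ≤ t → TauKdV.tau k l t n ∈ TauKdV.laurentRing d,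
      (∀ (t : ℤ) (n : Fin d → ℤ) (ht : 0 ≤ t),
        Irreducible (⟨TauKdV.tau k l t n, hR t n (by omega)⟩ : TauKdV.laurentRing d)) ∧
      (∀ (t s : ℤ) (n m : Fin d → ℤ) (ht : -4 ≤ t) (hs : -4 ≤ s), (t, n) ≠ (s, m) →
        IsRelPrime (⟨TauKdV.tau k l t n, hR t n ht⟩ : TauKdV.laurentRing d)
          ⟨TauKdV.tau k l s m, hR s m hs⟩) := by
  open TauKdV in
  -- A strict inequality between integers gains one more unit, hence 2.
  have hkl' : ∀ i j, k j + 2 ≤ l i * k i ∧ l j + 2 ≤ l i * k i := by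
    intro i j
    have h := hkl i j
    rw [max_lt_iff] at h
    obtain ⟨h1, h2⟩ := h
    zify
    constructor <;> linarith
  have hx := algebraicIndependent_gen (d := d)
  have hmem : ∀ t n, iter k l (gen (d := d)) t n ∈ laurentRing d := by
    intro t n
    rw [mem_laurentRing_iff]
    by_cases ht : 4 ≤ t
    · exact genRing_late_le _ ((goodAt hd hk hl hkl' t ht _ hx).mem n)
    · exact genRing_late_le _ (iter_mem_late k l hx (by omega) n)
  have hirr : ∀ t n (h : iter k l (gen (d := d)) t n ∈ laurentRing d), 4 ≤ t →
      Irreducible (⟨iter k l (gen (d := d)) t n, h⟩ : laurentRing d) := fun t n h ht =>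
    PrimeIn.irreducible ((goodAt hd hk hl hkl' t ht _ hx).prime n)
  refine ⟨fun t n _ => by rw [tau_eq_iter]; exact hmem _ n, fun t n ht => ?_,
    fun t s n m ht hs hne => ?_⟩
  · simp only [tau_eq_iter]
    exact hirr _ n _ (by omega)
  · simp only [tau_eq_iter]
    by_cases ht4 : 0 ≤ t
    · by_cases hs4 : 0 ≤ s
      · rw [(hirr _ n _ (by omega)).isRelPrime_iff_not_dvd, dvd_iff_dvdIn]
        refine not_dvdIn_iter_of_ne hd hk hl hkl' (by omega) (by omega) (fun h => hne ?_) hx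
        obtain ⟨h1, h2⟩ := Prod.ext_iff.1 h
        exact Prod.ext (by simp only at h1 ⊢; omega) h2
      · exact (isUnit_of_lt_four k l (t := (s + 4).toNat) (by omega) rfl).isRelPrime_right
    · exact (isUnit_of_lt_four k l (t := (t + 4).toNat) (by omega) rfl).isRelPrime_left
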